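/- Let $H$ be a finite hypergraph with vertex set $V(H)$, $|V(H)| = n$. Two distinct vertices are adjacent if some edge contains both; $N[v]$ denotes the set consisting of $v$ and all vertices adjacent to $v$, and $N[D]=\bigcup_{v\in D}N[v]$ for $D\subseteq V(H)$. In the domination game on $H$, two players, Dominator and Staller, alternately select vertices $v_1,v_2,\dots$ such that each selected vertex satisfies $N[v_i]\setminus N[\{v_1,\dots,v_{i-1}\}]\neq\emptyset$; the game is over when $N[\{v_1,\dots,v_d\}]=V(H)$. Dominator wants the game to have as few moves as possible, Staller as many as possible. The game domination number $\gamma_g(H)$ is the number $d$ of moves when Dominator starts and both players play optimally. If $H$ has no isolated vertices (every vertex lies in some edge) and no edge with exactly one element, then $$\gamma_g(H)\le \frac{5}{8}\,n .$$ -/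

import Mathlib

namespace Hypergraph

/-- The open neighborhood `N(v)`: the vertices different from `v` that share an edge with `v`. -/
def openNeighborhood {α : Type*} (H : Hypergraph α) (v : α) : Set α :=
  {u | u ≠ v ∧ H.Adj v u}

/-- The closed neighborhood `N[v] = N(v) ∪ {v}` of a vertex. -/
def closedNeighborhood {α : Type*} (H : Hypergraph α) (v : α) : Set α :=
  H.openNeighborhood v ∪ {v}

/-- The set `N[D]` of vertices dominated by a set `D` of vertices. -/
def dominated {α : Type*} (H : Hypergraph α) (D : Set α) : Set α :=
  ⋃ v ∈ D, H.closedNeighborhood v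

/-- `D` is a dominating set: `D ⊆ V(H)` and `N[D] = V(H)`. -/
def IsDominating {α : Type*} (H : Hypergraph α) (D : Set α) : Prop :=
  D ⊆ H.vertexSet ∧ H.dominated D = H.vertexSet

/-- When `D` is the set of vertices selected so far, selecting the vertex `v` is legal if it
enlarges the set of dominated vertices: `N[v] \ N[D] ≠ ∅`. -/
def IsLegalMove {α : Type*} (H : Hypergraph α) (D : Set α) (v : α) : Prop :=
  v ∈ H.vertexSet ∧ (H.closedNeighborhood v \ H.dominated D).Nonempty

/-- The two players of the domination game. -/
inductive Player : Type
  | dominator : Player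
  | staller : Player

/-- `H.EndsWithin k p D`: from the position in which the vertices of `D` have been selected and
player `p` has the next turn, Dominator can ensure, whatever Staller does, that the game is over
(the selected vertices form a dominating set) after at most `k` further moves, the moves of both
players being counted. On Dominator's turn some legal move must work, on Staller's turn every legal
move must work. -/
def EndsWithin {α : Type*} (H : Hypergraph α) : ℕ → Player → Set α → Prop
  | 0, _, D => H.IsDominating D
  | k + 1, Player.dominator, D => H.IsDominating D ∨
      ∃ v, H.IsLegalMove D v ∧ EndsWithin H k Player.staller (insert v D)
  | k + 1, Player.staller, D => H.IsDominating D ∨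
      ∀ v, H.IsLegalMove D v → EndsWithin H k Player.dominator (insert v D)

/-- The game domination number `γ_g(H)`: the number of moves in the domination game when Dominator
makes the first move and both players play optimally, that is, the least `k` such that Dominator
can ensure that the game is over after at most `k` moves. On a finite vertex set such a `k` exists,
see `exists_endsWithin`. -/
noncomputable def gameDominationNumber {α : Type*} (H : Hypergraph α) : ℕ :=
  sInf {k | H.EndsWithin k Player.dominator ∅}

theorem closedNeighborhood_subset {α : Type*} (H : Hypergraph α) {v : α} (hv : v ∈ H.vertexSet) :
    H.closedNeighborhood v ⊆ H.vertexSet := by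
  rintro u (⟨-, e, he, -, hu⟩ | hu)
  · exact H.subset_vertexSet_of_mem_edgeSet' he hu
  · exact hu ▸ hv

theorem dominated_subset {α : Type*} (H : Hypergraph α) {D : Set α} (hD : D ⊆ H.vertexSet) :
    H.dominated D ⊆ H.vertexSet :=
  Set.iUnion₂_subset fun _ hv => H.closedNeighborhood_subset (hD hv)

theorem dominated_insert {α : Type*} (H : Hypergraph α) (D : Set α) (v : α) :
    H.dominated (insert v D) = H.closedNeighborhood v ∪ H.dominated D :=
  Set.biUnion_insert _ _ _

/-- The game is not over exactly when the player on turn has a legal move. -/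
theorem not_isDominating_iff {α : Type*} (H : Hypergraph α) {D : Set α} (hD : D ⊆ H.vertexSet) :
    ¬ H.IsDominating D ↔ ∃ v, H.IsLegalMove D v := by
  constructor
  · intro h
    have h1 : ¬ H.vertexSet ⊆ H.dominated D := fun h2 =>
      h ⟨hD, Set.Subset.antisymm (H.dominated_subset hD) h2⟩
    obtain ⟨v, hv, hv'⟩ := Set.not_subset.1 h1
    exact ⟨v, hv, v, Or.inr rfl, hv'⟩
  · rintro ⟨v, hv, u, hu, hu'⟩ ⟨-, h⟩
    exact hu' (h ▸ H.closedNeighborhood_subset hv hu)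

/-- On a finite vertex set every game is finite. -/
theorem exists_endsWithin {α : Type*} (H : Hypergraph α) (hfin : H.vertexSet.Finite) (k : ℕ) :
    ∀ (p : Player) (D : Set α), D ⊆ H.vertexSet → (H.vertexSet \ H.dominated D).ncard ≤ k →
      H.EndsWithin k p D := by
  induction k with
  | zero =>
    intro p D hD hk
    have h0 : H.vertexSet \ H.dominated D = ∅ :=
      (Set.ncard_eq_zero (hfin.subset Set.sdiff_subset)).1 (Nat.le_zero.1 hk)
    have : H.IsDominating D :=
      ⟨hD, Set.Subset.antisymm (H.dominated_subset hD) (Set.sdiff_eq_empty.1 h0)⟩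
    cases p <;> exact this
  | succ k ih =>
    intro p D hD hk
    have key : ∀ q v, H.IsLegalMove D v → H.EndsWithin k q (insert v D) := by
      rintro q v ⟨hv, u, hu, hu'⟩
      refine ih q _ (Set.insert_subset hv hD) (Nat.lt_succ_iff.1 (lt_of_lt_of_le ?_ hk))
      refine Set.ncard_lt_ncard ?_ (hfin.subset Set.sdiff_subset)
      rw [dominated_insert]
      refine ⟨Set.sdiff_subset_sdiff_right Set.subset_union_right, fun h => ?_⟩
      exact (h ⟨H.closedNeighborhood_subset hv hu, hu'⟩).2 (Or.inl hu)
    cases p with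
    | dominator =>
      by_cases h : H.IsDominating D
      · exact Or.inl h
      · obtain ⟨v, hv⟩ := (H.not_isDominating_iff hD).1 h
        exact Or.inr ⟨v, hv, key _ v hv⟩
    | staller => exact Or.inr fun v hv => key _ v hv

end Hypergraph

/-! Only the adjacency graph matters, and it has no isolated vertex because no edge is a singleton.
An undominated vertex weighs 10, a dominated one 0, 5, 6 or 8. The potential, the total weight,
starts at `10 n` and never increases. If Dominator can make a move cost 16 on average, at most `10 n
/ 16 = 5 n / 8` moves occur. `Payable` is the local form of this: the gains add up to 16 and 32
after one round, or else to 48 and 64 after a second one. `exists_payable` provides it in every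
unfinished position, and `Matches.endsWithin_of_potential` iterates it.

The normal weight of a dominated vertex that can still dominate something is 6. Twins weigh 5, since
their only prospect is the same isolated vertex. A dominated vertex next to two stems or hubs weighs
8; the surplus 2 is collected in `Critical.not_stems`. The price is that an undominated vertex may
drop by 2 only, which does not happen in calm positions; in the others Dominator gains 24, or 22
with all replies gaining 10 (`exists_gain_of_not_calm`).

In a calm position every reply gains 10, so a move gaining 22 suffices. If there is none
(`Critical`), the undominated vertices induce isolated vertices, single edges and cycles of length
at least four. Dominator then usually opens with a gain of 18 to 20. A reply gaining 14 settles the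
round; the remaining, weak replies are very restricted (`Calm.weakReply_of_gain_lt`), and a strong
second move brings the total to 54, so that the last reply completes 64. The cases are
`Critical.payable_of_pair`, `Critical.payable_of_square`, `Critical.payable_of_path` for cycles of
length at least six, `IsPentagon.payable_of_joined` and `IsPentagon.payable_of_not_joined` for
pentagons, and `payable_of_isolated`. -/

namespace DominationGame

open Classical

/-! ### Positions, weights and the potential. -/

/-- The undominated vertices left after the vertex `v` is selected. -/
noncomputable def play {V : Type*} (G : SimpleGraph V) (W : Finset V) (v : V) : Finset V :=
  W.filter fun x => x ≠ v ∧ ¬ G.Adj v x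

/-- Selecting `v` dominates a vertex of `W`. -/
def Legal {V : Type*} (G : SimpleGraph V) (W : Finset V) (v : V) : Prop :=
  ∃ x ∈ W, x = v ∨ G.Adj v x

/-- An undominated vertex with an undominated neighbor of degree one in `G`. -/
def IsStem {V : Type*} (G : SimpleGraph V) (W : Finset V) (u : V) : Prop :=
  u ∈ W ∧ ∃ w ∈ W, ∀ t, G.Adj w t ↔ t = u

/-- An undominated vertex with at least three stems as neighbors. -/
def IsHub {V : Type*} (G : SimpleGraph V) (W : Finset V) (c : V) : Prop :=
  c ∈ W ∧ ∃ s₁ s₂ s₃, s₁ ≠ s₂ ∧ s₁ ≠ s₃ ∧ s₂ ≠ s₃ ∧ G.Adj c s₁ ∧ G.Adj c s₂ ∧ G.Adj c s₃ ∧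
    IsStem G W s₁ ∧ IsStem G W s₂ ∧ IsStem G W s₃

/-- A stem or a hub. -/
def IsCore {V : Type*} (G : SimpleGraph V) (W : Finset V) (c : V) : Prop :=
  IsStem G W c ∨ IsHub G W c

/-- At least two neighbors of `x` are stems or hubs. -/
def HasTwoCores {V : Type*} (G : SimpleGraph V) (W : Finset V) (x : V) : Prop :=
  ∃ a b, a ≠ b ∧ G.Adj x a ∧ G.Adj x b ∧ IsCore G W a ∧ IsCore G W b

/-- `x` is dominated and `z` is its only undominated neighbor. -/
def IsLeafAt {V : Type*} (G : SimpleGraph V) (W : Finset V) (x z : V) : Prop :=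
  x ∉ W ∧ z ∈ W ∧ G.Adj x z ∧ ∀ t ∈ W, G.Adj x t → t = z

/-- `x` is one of at least two leaves at a vertex without undominated neighbors. -/
def IsTwin {V : Type*} (G : SimpleGraph V) (W : Finset V) (x : V) : Prop :=
  ∃ z y, y ≠ x ∧ IsLeafAt G W x z ∧ IsLeafAt G W y z ∧ ∀ t ∈ W, ¬ G.Adj z t

/-- The weight of a vertex when `W` is the set of undominated vertices. -/
noncomputable def weight {V : Type*} (G : SimpleGraph V) (W : Finset V) (x : V) : ℕ :=
  if x ∈ W then 10 else if ∀ z ∈ W, ¬ G.Adj x z then 0 else if HasTwoCores G W x then 8 else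
    if IsTwin G W x then 5 else 6

/-- The total weight of the vertices. -/
noncomputable def potential {V : Type*} [Fintype V] (G : SimpleGraph V) (W : Finset V) : ℕ :=
  ∑ x, weight G W x

/-! ### Bounds on the weight and on its drops. -/

section Weight

variable {V : Type*} {G : SimpleGraph V} {W W' : Finset V} {u v x y z t : V}

theorem mem_play : x ∈ play G W v ↔ x ∈ W ∧ x ≠ v ∧ ¬ G.Adj v x := by
  simp [play]

theorem play_subset : play G W v ⊆ W := Finset.filter_subset _ _

theorem play_ssubset (h : Legal G W v) : play G W v ⊂ W := by
  obtain ⟨x, hx, h⟩ := h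
  refine (Finset.ssubset_iff_of_subset play_subset).2 ⟨x, hx, fun h' => ?_⟩
  rw [mem_play] at h'
  exact h.elim h'.2.1 h'.2.2

theorem weight_of_mem (hx : x ∈ W) : weight G W x = 10 := by
  simp [weight, hx]

theorem weight_eq_zero (hx : x ∉ W) (h : ∀ z ∈ W, ¬ G.Adj x z) : weight G W x = 0 := by
  rw [weight, if_neg hx, if_pos h]

theorem weight_le_eight (hx : x ∉ W) : weight G W x ≤ 8 := by
  rw [weight]; split_ifs <;> simp

theorem weight_le_six (hx : x ∉ W) (h : ¬ HasTwoCores G W x) : weight G W x ≤ 6 := by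
  rw [weight]; split_ifs <;> simp

theorem HasTwoCores.exists_ne (h : HasTwoCores G W x) :
    ∃ a b, a ≠ b ∧ a ∈ W ∧ b ∈ W ∧ G.Adj x a ∧ G.Adj x b := by
  obtain ⟨a, b, hab, ha, hb, h1, h2⟩ := h
  refine ⟨a, b, hab, ?_, ?_, ha, hb⟩
  · exact h1.elim (fun h => h.1) fun h => h.1
  · exact h2.elim (fun h => h.1) fun h => h.1

theorem weight_le_six_of_unique (hx : x ∉ W) (h : ∀ t ∈ W, G.Adj x t → t = z) :
    weight G W x ≤ 6 := by
  refine weight_le_six hx fun h2 => ?_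
  obtain ⟨a, b, hab, ha, hb, h1, h2⟩ := h2.exists_ne
  exact hab ((h a ha h1).trans (h b hb h2).symm)

theorem weight_le_five (hx : IsLeafAt G W x z) (hy : IsLeafAt G W y z) (hxy : y ≠ x)
    (hz : ∀ t ∈ W, ¬ G.Adj z t) : weight G W x ≤ 5 := by
  have h1 : ¬ HasTwoCores G W x := fun h2 => by
    obtain ⟨a, b, hab, ha, hb, h1, h2⟩ := h2.exists_ne
    exact hab ((hx.2.2.2 a ha h1).trans (hx.2.2.2 b hb h2).symm)
  have h2 : IsTwin G W x := ⟨z, y, hxy, hx, hy, hz⟩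
  rw [weight, if_neg hx.1]; split_ifs <;> simp

theorem five_le_weight (hz : z ∈ W) (h : G.Adj x z) : 5 ≤ weight G W x := by
  have : ¬ ∀ z ∈ W, ¬ G.Adj x z := fun h' => h' z hz h
  rw [weight]; split_ifs <;> simp

theorem eight_le_weight (h : HasTwoCores G W x) : 8 ≤ weight G W x := by
  obtain ⟨a, b, hab, ha, hb, h1, h2⟩ := h.exists_ne
  have : ¬ ∀ z ∈ W, ¬ G.Adj x z := fun h' => h' a ha h1
  rw [weight]; split_ifs <;> simp

theorem six_le_weight_of_ne (hy : y ∈ W) (hz : z ∈ W) (hyz : y ≠ z) (h : G.Adj x y)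
    (h' : G.Adj x z) : 6 ≤ weight G W x := by
  have h1 : ¬ ∀ z ∈ W, ¬ G.Adj x z := fun h' => h' y hy h
  have h2 : ¬ IsTwin G W x := by
    rintro ⟨a, b, hab, hx, -⟩
    exact hyz ((hx.2.2.2 y hy h).trans (hx.2.2.2 z hz h').symm)
  rw [weight]; split_ifs <;> simp

theorem six_le_weight_of_adj (hz : z ∈ W) (ht : t ∈ W) (h : G.Adj x z) (h' : G.Adj z t) :
    6 ≤ weight G W x := by
  have h1 : ¬ ∀ z ∈ W, ¬ G.Adj x z := fun h' => h' z hz h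
  have h2 : ¬ IsTwin G W x := by
    rintro ⟨a, b, hab, hx, -, h3⟩
    obtain rfl := hx.2.2.2 z hz h
    exact h3 t ht h'
  rw [weight]; split_ifs <;> simp

theorem IsStem.mono (h : IsStem G W' x) (hW : W' ⊆ W) : IsStem G W x := by
  obtain ⟨h1, w, hw, h2⟩ := h
  exact ⟨hW h1, w, hW hw, h2⟩

theorem IsHub.mono (h : IsHub G W' x) (hW : W' ⊆ W) : IsHub G W x := by
  obtain ⟨h1, a, b, c, hab, hac, hbc, ha, hb, hc, h2, h3, h4⟩ := h
  exact ⟨hW h1, a, b, c, hab, hac, hbc, ha, hb, hc, h2.mono hW, h3.mono hW, h4.mono hW⟩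

theorem IsCore.mono (h : IsCore G W' x) (hW : W' ⊆ W) : IsCore G W x :=
  h.imp (fun h => h.mono hW) fun h => h.mono hW

theorem HasTwoCores.mono (h : HasTwoCores G W' x) (hW : W' ⊆ W) : HasTwoCores G W x := by
  obtain ⟨a, b, hab, ha, hb, h1, h2⟩ := h
  exact ⟨a, b, hab, ha, hb, h1.mono hW, h2.mono hW⟩

theorem IsLeafAt.of_subset (h : IsLeafAt G W x z) (hW : W' ⊆ W) (hz : z ∈ W') :
    IsLeafAt G W' x z :=
  ⟨fun h' => h.1 (hW h'), hz, h.2.2.1, fun t ht => h.2.2.2 t (hW ht)⟩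

/-- The danger is a rise from 5 or 6. Cores of the smaller set are cores of the larger one, so 8
cannot newly appear. A twin remains a twin while its center is undominated, and has weight 0
afterwards. -/
theorem weight_mono (hW : W' ⊆ W) : weight G W' x ≤ weight G W x := by
  by_cases hx : x ∈ W
  · rw [weight_of_mem hx, weight]; split_ifs <;> simp
  have hx' : x ∉ W' := fun h => hx (hW h)
  by_cases h0 : ∀ z ∈ W', ¬ G.Adj x z
  · rw [weight_eq_zero hx' h0]; exact Nat.zero_le _
  by_cases h1 : HasTwoCores G W' x
  · exact (weight_le_eight hx').trans (eight_le_weight (h1.mono hW))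
  by_cases h2 : IsTwin G W x
  · obtain ⟨z, y, hyx, hx1, hy1, hz⟩ := h2
    have hz' : z ∈ W' := by
      push Not at h0
      obtain ⟨t, ht, hxt⟩ := h0
      exact hx1.2.2.2 t (hW ht) hxt ▸ ht
    exact (weight_le_five (hx1.of_subset hW hz') (hy1.of_subset hW hz') hyx
      fun t ht => hz t (hW ht)).trans (five_le_weight hx1.2.1 hx1.2.2.1)
  · have h3 : ¬ ∀ z ∈ W, ¬ G.Adj x z := fun h => h0 fun z hz => h z (hW hz)
    refine (weight_le_six hx' h1).trans ?_
    rw [weight]; split_ifs <;> simp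

theorem drop_ten (hx : x ∈ W) (hx' : x ∉ W') (h : ∀ z ∈ W', ¬ G.Adj x z) :
    weight G W' x + 10 ≤ weight G W x := by
  rw [weight_of_mem hx, weight_eq_zero hx' h]

theorem drop_two (hx : x ∈ W) (hx' : x ∉ W') : weight G W' x + 2 ≤ weight G W x := by
  have := weight_le_eight (G := G) hx'
  rw [weight_of_mem hx]; omega

theorem drop_four (hx : x ∈ W) (hx' : x ∉ W') (h : ¬ HasTwoCores G W' x) :
    weight G W' x + 4 ≤ weight G W x := by
  have := weight_le_six hx' h
  rw [weight_of_mem hx]; omega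

theorem drop_four_of_unique (hx : x ∈ W) (hx' : x ∉ W') (h : ∀ t ∈ W', G.Adj x t → t = z) :
    weight G W' x + 4 ≤ weight G W x := by
  have := weight_le_six_of_unique (G := G) hx' h
  rw [weight_of_mem hx]; omega

theorem drop_six_of_ne (hx' : x ∉ W') (h : ∀ z ∈ W', ¬ G.Adj x z)
    (hy : y ∈ W) (hz : z ∈ W) (hyz : y ≠ z) (h1 : G.Adj x y)
    (h2 : G.Adj x z) : weight G W' x + 6 ≤ weight G W x := by
  have := six_le_weight_of_ne hy hz hyz h1 h2
  rw [weight_eq_zero hx' h]; omega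

theorem drop_six_of_adj (hx' : x ∉ W') (h : ∀ z ∈ W', ¬ G.Adj x z)
    (hz : z ∈ W) (ht : t ∈ W) (h1 : G.Adj x z)
    (h2 : G.Adj z t) : weight G W' x + 6 ≤ weight G W x := by
  have := six_le_weight_of_adj hz ht h1 h2
  rw [weight_eq_zero hx' h]; omega

theorem drop_five (hx' : x ∉ W') (h : ∀ z ∈ W', ¬ G.Adj x z)
    (hz : z ∈ W) (h1 : G.Adj x z) : weight G W' x + 5 ≤ weight G W x := by
  have := five_le_weight hz h1
  rw [weight_eq_zero hx' h]; omega

end Weight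

/-! ### Adding up drops. -/

section Gain

variable {V : Type*} [Fintype V] {G : SimpleGraph V} {W W' : Finset V}

/-- Drops at distinct vertices add up, since by `weight_mono` no other vertex gets heavier. -/
theorem potential_list (hW : W' ⊆ W) (l : List (V × ℕ)) (hl : (l.map Prod.fst).Nodup)
    (h : ∀ p ∈ l, weight G W' p.1 + p.2 ≤ weight G W p.1) :
    potential G W' + (l.map Prod.snd).sum ≤ potential G W := by
  have h1 : ∀ W : Finset V, potential G W = ((l.map Prod.fst).map (weight G W)).sum +
      ∑ x ∈ (l.map Prod.fst).toFinsetᶜ, weight G W x := fun W => by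
    rw [← List.sum_toFinset _ hl, Finset.sum_add_sum_compl, potential]
  have h2 : ∑ x ∈ (l.map Prod.fst).toFinsetᶜ, weight G W' x ≤
      ∑ x ∈ (l.map Prod.fst).toFinsetᶜ, weight G W x :=
    Finset.sum_le_sum fun _ _ => weight_mono hW
  have h3 : ((l.map Prod.fst).map (weight G W')).sum + (l.map Prod.snd).sum ≤
      ((l.map Prod.fst).map (weight G W)).sum := by
    clear h1 h2 hl
    induction l with
    | nil => simp
    | cons a l ih =>
      have := ih fun p hp => h p (List.mem_cons_of_mem _ hp)
      have := h a List.mem_cons_self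
      simp only [List.map_cons, List.sum_cons] at *
      omega
  rw [h1 W, h1 W']; omega

variable {a b c d e f : V} {i j k l m n : ℕ}

theorem gain_one (hW : W' ⊆ W) (ha : weight G W' a + i ≤ weight G W a) :
    potential G W' + i ≤ potential G W := by
  simpa using potential_list (G := G) hW [(a, i)] (by simp) (by simpa using ha)

theorem gain_two (hW : W' ⊆ W) (hl : [a, b].Nodup) (ha : weight G W' a + i ≤ weight G W a)
    (hb : weight G W' b + j ≤ weight G W b) :
    potential G W' + (i + j) ≤ potential G W := by
  simpa using potential_list (G := G) hW [(a, i), (b, j)] hl (by simp; grind)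

theorem gain_three (hW : W' ⊆ W) (hl : [a, b, c].Nodup)
    (ha : weight G W' a + i ≤ weight G W a) (hb : weight G W' b + j ≤ weight G W b)
    (hc : weight G W' c + k ≤ weight G W c) :
    potential G W' + (i + j + k) ≤ potential G W := by
  simpa [add_assoc] using potential_list (G := G) hW [(a, i), (b, j), (c, k)] hl (by simp; grind)

theorem gain_four (hW : W' ⊆ W) (hl : [a, b, c, d].Nodup)
    (ha : weight G W' a + i ≤ weight G W a) (hb : weight G W' b + j ≤ weight G W b)
    (hc : weight G W' c + k ≤ weight G W c) (hd : weight G W' d + l ≤ weight G W d) :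
    potential G W' + (i + j + k + l) ≤ potential G W := by
  simpa [add_assoc] using
    potential_list (G := G) hW [(a, i), (b, j), (c, k), (d, l)] hl (by simp; grind)

theorem gain_five (hW : W' ⊆ W) (hl : [a, b, c, d, e].Nodup)
    (ha : weight G W' a + i ≤ weight G W a) (hb : weight G W' b + j ≤ weight G W b)
    (hc : weight G W' c + k ≤ weight G W c) (hd : weight G W' d + l ≤ weight G W d)
    (he : weight G W' e + m ≤ weight G W e) :
    potential G W' + (i + j + k + l + m) ≤ potential G W := by
  simpa [add_assoc] using
    potential_list (G := G) hW [(a, i), (b, j), (c, k), (d, l), (e, m)] hl (by simp; grind)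

theorem gain_six (hW : W' ⊆ W) (hl : [a, b, c, d, e, f].Nodup)
    (ha : weight G W' a + i ≤ weight G W a) (hb : weight G W' b + j ≤ weight G W b)
    (hc : weight G W' c + k ≤ weight G W c) (hd : weight G W' d + l ≤ weight G W d)
    (he : weight G W' e + m ≤ weight G W e) (hf : weight G W' f + n ≤ weight G W f) :
    potential G W' + (i + j + k + l + m + n) ≤ potential G W := by
  simpa [add_assoc] using
    potential_list (G := G) hW [(a, i), (b, j), (c, k), (d, l), (e, m), (f, n)] hl
      (by simp; grind)

theorem legal_of_gain {v : V} (h : potential G (play G W v) + (i + 1) ≤ potential G W) :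
    Legal G W v := by
  by_contra hv
  have : play G W v = W := Finset.filter_true_of_mem fun x hx => by
    simp only [Legal, not_exists, not_and, not_or] at hv
    exact hv x hx
  rw [this] at h; omega

/-- Every legal move lowers the potential by at least eight. -/
theorem gain_eight_of_legal {v : V} (h : Legal G W v) :
    potential G (play G W v) + 8 ≤ potential G W := by
  have hv' : v ∉ play G W v := by simp [mem_play]
  have hv0 : ∀ z ∈ play G W v, ¬ G.Adj v z := fun z hz => (mem_play.1 hz).2.2
  by_cases hv : v ∈ W
  · have := gain_one play_subset (drop_ten hv hv' hv0)
    omega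
  obtain ⟨x, hx, rfl | hvx⟩ := h
  · exact absurd hx hv
  have hx' : x ∉ play G W v := by simp [mem_play, hvx]
  have hne : [v, x].Nodup := by simp [hvx.ne]
  by_cases hiso : ∃ t ∈ W, G.Adj x t
  -- The tight case 6 + 2: `x` may fall only from 10 to 8.
  · obtain ⟨t, ht, hxt⟩ := hiso
    have := gain_two play_subset hne (drop_six_of_adj hv' hv0 hx ht hvx hxt) (drop_two hx hx')
    omega
  · push Not at hiso
    have := gain_two play_subset hne (drop_five hv' hv0 hx hvx)
      (drop_ten hx hx' fun z hz => hiso z (play_subset hz))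
    omega

end Gain

/-! ### Positions that are not calm. -/

/-- The only undominated neighbor of a stem is its leaf. -/
def Calm {V : Type*} (G : SimpleGraph V) (W : Finset V) : Prop :=
  ∀ u w y, u ∈ W → w ∈ W → y ∈ W → (∀ t, G.Adj w t ↔ t = u) → G.Adj u y → y = w

theorem IsHub.ne_of_unique {V : Type*} {G : SimpleGraph V} {W : Finset V} {u w y : V}
    (hy : IsHub G W y) (hw : ∀ t, G.Adj w t ↔ t = u) : y ≠ w := by
  rintro rfl
  obtain ⟨-, a, b, c, hab, -, -, ha, hb, -⟩ := hy
  exact hab (((hw a).1 ha).trans ((hw b).1 hb).symm)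

section Hot

variable {V : Type*} [Fintype V] {G : SimpleGraph V} {W : Finset V} {u w y t : V}

/-- Playing the stem `u` gains 10 + 10 with its leaf and 2 for every further undominated neighbor;
two of these reach the excluded 24. -/
theorem hot_neighbors (H : ∀ v, ¬ potential G (play G W v) + 24 ≤ potential G W)
    (hu : u ∈ W) (hw : w ∈ W) (hy : y ∈ W) (hwu : ∀ t, G.Adj w t ↔ t = u) (huy : G.Adj u y)
    (hyw : y ≠ w) (ht : t ∈ W) (hut : G.Adj u t) : t = w ∨ t = y := by
  by_contra! h
  have huw : G.Adj u w := ((hwu u).2 rfl).symm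
  have h1 := gain_four (W' := play G W u) (a := u) (b := w) (c := y) (d := t) play_subset
    (by simp; grind [huw.ne, huy.ne, hut.ne])
    (drop_ten hu (by simp [mem_play]) fun z hz => (mem_play.1 hz).2.2)
    (drop_ten hw (by simp [mem_play, huw]) fun z hz h => (mem_play.1 hz).2.1 ((hwu z).1 h))
    (drop_two hy (by simp [mem_play, huy])) (drop_two ht (by simp [mem_play, hut]))
  exact H u (by omega)

/-- Playing `u` gains 24 unless `y` keeps weight 8, so `y` has two cores besides `u`. Neither is a
hub, because playing it would gain 10 + 3 · 4, and 2 more for `y`. Thus `y` has three stems as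
neighbors. -/
theorem hot_isHub (H : ∀ v, ¬ potential G (play G W v) + 24 ≤ potential G W)
    (hu : u ∈ W) (hw : w ∈ W) (hy : y ∈ W) (hwu : ∀ t, G.Adj w t ↔ t = u) (huy : G.Adj u y)
    (hyw : y ≠ w) : IsHub G W y := by
  have huw : G.Adj u w := ((hwu u).2 rfl).symm
  have h2 : HasTwoCores G (play G W u) y := by
    by_contra h2
    have h1 := gain_three (W' := play G W u) (a := u) (b := w) (c := y) play_subset
      (by simp; grind [huw.ne, huy.ne])
      (drop_ten hu (by simp [mem_play]) fun z hz => (mem_play.1 hz).2.2)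
      (drop_ten hw (by simp [mem_play, huw]) fun z hz h => (mem_play.1 hz).2.1 ((hwu z).1 h))
      (drop_four hy (by simp [mem_play, huy]) h2)
    exact H u (by omega)
  have key : ∀ k, G.Adj y k → k ≠ u → IsHub G W k → False := by
    intro k hyk hku hk
    obtain ⟨hkW, a, b, c, hab, hac, hbc, ha, hb, hc, sa, sb, sc⟩ := id hk
    -- By `hot_neighbors` a stem next to `k` sees only its leaf and `k`, so it falls to 6 at most.
    have h3 : ∀ s, G.Adj k s → IsStem G W s →
        weight G (play G W k) s + 4 ≤ weight G W s ∧ y ≠ s := by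
      rintro s hks ⟨hs, l, hl, hls⟩
      have hkl : k ≠ l := hk.ne_of_unique hls
      have h4 := fun t => hot_neighbors (t := t) H hs hl hkW hls hks.symm hkl
      refine ⟨drop_four_of_unique (z := l) hs (by simp [mem_play, hks]) fun t ht hst => ?_, ?_⟩
      · exact (h4 t (play_subset ht) hst).resolve_right (mem_play.1 ht).2.1
      · rintro rfl
        rcases h4 u hu huy.symm with rfl | rfl
        · exact hyw ((hls w).1 huw).symm
        · exact hku rfl
    have h1 := gain_five (W' := play G W k) (a := k) (b := a) (c := b) (d := c) (e := y) play_subset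
      (by simp; grind [ha.ne, hb.ne, hc.ne, hyk.ne])
      (drop_ten hkW (by simp [mem_play]) fun z hz => (mem_play.1 hz).2.2)
      (h3 a ha sa).1 (h3 b hb sb).1 (h3 c hc sc).1 (drop_two hy (by simp [mem_play, hyk.symm]))
    exact H k (by omega)
  obtain ⟨a, b, hab, ha, hb, ca, cb⟩ := h2
  have hau : a ≠ u ∧ IsCore G W a := ⟨by
    have : a ∈ play G W u := ca.elim (fun h => h.1) fun h => h.1
    exact (mem_play.1 this).2.1, ca.mono play_subset⟩
  have hbu : b ≠ u ∧ IsCore G W b := ⟨by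
    have : b ∈ play G W u := cb.elim (fun h => h.1) fun h => h.1
    exact (mem_play.1 this).2.1, cb.mono play_subset⟩
  have sa := hau.2.resolve_right (key a ha hau.1)
  have sb := hbu.2.resolve_right (key b hb hbu.1)
  exact ⟨hy, u, a, b, hau.1.symm, hbu.1.symm, hab, huy.symm, ha, hb, ⟨hu, w, hw, hwu⟩, sa, sb⟩

/-- Playing the hub and lowering three stems gains 10 + 3 · 4 = 22, so any additional drop of 2 is
excluded. -/
theorem stem_of_adj_hub (H : ∀ v, ¬ potential G (play G W v) + 24 ≤ potential G W)
    (hy : IsHub G W y) :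
    (∀ t ∈ W, G.Adj y t → IsStem G W t) ∧ potential G (play G W y) + 22 ≤ potential G W ∧
    ∀ r, r ∉ W → weight G (play G W y) r + 2 ≤ weight G W r → False := by
  obtain ⟨hyW, a, b, c, hab, hac, hbc, ha, hb, hc, sa, sb, sc⟩ := id hy
  have h3 : ∀ s, G.Adj y s → IsStem G W s → weight G (play G W y) s + 4 ≤ weight G W s := by
    rintro s hks ⟨hs, l, hl, hls⟩
    have hkl : y ≠ l := hy.ne_of_unique hls
    have h4 := fun t => hot_neighbors (t := t) H hs hl hyW hls hks.symm hkl
    refine drop_four_of_unique (z := l) hs (by simp [mem_play, hks]) fun t ht hst => ?_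
    exact (h4 t (play_subset ht) hst).resolve_right (mem_play.1 ht).2.1
  have hyd : weight G (play G W y) y + 10 ≤ weight G W y :=
    drop_ten hyW (by simp [mem_play]) fun z hz => (mem_play.1 hz).2.2
  refine ⟨fun t ht hyt => ?_, ?_, fun r hr hrd => ?_⟩
  · by_contra hst
    have h1 := gain_five (W' := play G W y) (a := y) (b := a) (c := b) (d := c) (e := t)
      play_subset (by simp; grind [ha.ne, hb.ne, hc.ne, hyt.ne]) hyd
      (h3 a ha sa) (h3 b hb sb) (h3 c hc sc) (drop_two ht (by simp [mem_play, hyt]))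
    exact H y (by omega)
  · have h1 := gain_four (W' := play G W y) (a := y) (b := a) (c := b) (d := c)
      play_subset (by simp; grind [ha.ne, hb.ne, hc.ne]) hyd
      (h3 a ha sa) (h3 b hb sb) (h3 c hc sc)
    omega
  · have h1 := gain_five (W' := play G W y) (a := y) (b := a) (c := b) (d := c) (e := r)
      play_subset (by simp; grind [ha.ne, hb.ne, hc.ne, sa.1, sb.1, sc.1]) hyd
      (h3 a ha sa) (h3 b hb sb) (h3 c hc sc) hrd
    exact H y (by omega)

/-- In a position that is not calm, Dominator has a move that pays for the next two moves. -/
theorem exists_gain_of_not_calm (hW : ¬ Calm G W) :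
    ∃ v, potential G (play G W v) + 24 ≤ potential G W ∨
      (potential G (play G W v) + 22 ≤ potential G W ∧ ∀ r, Legal G (play G W v) r →
        potential G (play G (play G W v) r) + 10 ≤ potential G (play G W v)) := by
  by_contra! H'
  have H : ∀ v, ¬ potential G (play G W v) + 24 ≤ potential G W := fun v => not_le.2 (H' v).1
  simp only [Calm, not_forall] at hW
  obtain ⟨u, w, y, hu, hw, hy, hwu, huy, hyw⟩ := hW
  have hub := hot_isHub H hu hw hy hwu huy hyw
  clear hu hw hwu huy hyw
  obtain ⟨hy1, hy2, hy3⟩ := stem_of_adj_hub H hub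
  -- Some reply `r` to the hub gains less than 10. This leaves only 6 for `r` itself and less than 4
  -- for its single undominated neighbor `z`, which must keep two cores.
  obtain ⟨r, hr, hlt⟩ := (H' y).2 hy2
  set W1 := play G W y with hW1
  have hrr : r ∉ play G W1 r := by simp [mem_play]
  have hr0 : ∀ z ∈ play G W1 r, ¬ G.Adj r z := fun z hz => (mem_play.1 hz).2.2
  have hrW1 : r ∉ W1 := fun h => by
    have := gain_one play_subset (drop_ten h hrr hr0); omega
  obtain ⟨z, hz, rfl | hrz⟩ := hr
  · exact hrW1 hz
  have hz' : z ∉ play G W1 r := by simp [mem_play, hrz]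
  have hziso : ∃ t ∈ W1, G.Adj z t := by
    by_contra! h
    have := gain_two play_subset (by simp [hrz.ne]) (drop_five hrr hr0 hz hrz)
      (drop_ten hz hz' fun t ht => h t (play_subset ht))
    omega
  obtain ⟨t, ht, hzt⟩ := hziso
  have hr6 := drop_six_of_adj hrr hr0 hz ht hrz hzt
  have huniq : ∀ q ∈ W1, G.Adj r q → q = z := by
    intro q hq hrq
    by_contra hqz
    have := gain_three (a := r) (b := z) (c := q) play_subset
      (by simp; grind [hrz.ne, hrq.ne]) hr6 (drop_two hz hz')
      (drop_two hq (by simp [mem_play, hrq]))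
    omega
  have h2 : HasTwoCores G (play G W1 r) z := by
    by_contra h2
    have := gain_two play_subset (by simp [hrz.ne]) hr6 (drop_four hz hz' h2)
    omega
  have hzW : z ∈ W := play_subset hz
  obtain ⟨a, b, hab, haz, hbz, ca, cb⟩ := h2.mono (play_subset.trans play_subset)
  have key : ∀ a b, a ≠ b → G.Adj z a → G.Adj z b → IsCore G W a → IsCore G W b →
      IsStem G W a := by
    intro a b hab haz hbz ca cb
    refine ca.resolve_right fun ha => ?_
    obtain ⟨-, l, hl, hlz⟩ := (stem_of_adj_hub H ha).1 z hzW haz.symm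
    have hal := ha.ne_of_unique hlz
    rcases hot_neighbors H hzW hl ha.1 hlz haz hal (cb.elim (fun h => h.1) fun h => h.1) hbz
      with rfl | rfl
    · rcases cb with ⟨-, q, hq, hqb⟩ | hb
      · obtain rfl := (hlz q).1 ((hqb b).2 rfl).symm
        exact hab ((hqb a).1 haz)
      · exact hb.ne_of_unique hlz rfl
    · exact hab rfl
  have sa := key a b hab haz hbz ca cb
  have hzhub : IsHub G W z := by
    obtain ⟨ha, l, hl, hla⟩ := sa
    refine hot_isHub H ha hl hzW hla haz.symm ?_
    rintro rfl
    exact hab ((hla b).1 hbz).symm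
  have hrW : r ∉ W := by
    intro h
    have hry : r ≠ y := by
      rintro rfl
      exact (mem_play.1 hz).2.2 hrz
    have hyr : G.Adj y r := by
      by_contra h'
      exact hrW1 (mem_play.2 ⟨h, hry, h'⟩)
    obtain ⟨-, l, hl, hlr⟩ := hy1 r h hyr
    rcases hot_neighbors H h hl hy hlr hyr.symm (hub.ne_of_unique hlr) hzW hrz with h | rfl
    · exact hzhub.ne_of_unique hlr h
    · exact (mem_play.1 hz).2.1 rfl
  -- Either `r` falls from 8 to 6 when the hub `y` is played, or `z` is its sole undominated
  -- neighbor and playing the hub `z` removes its weight. `stem_of_adj_hub` excludes both.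
  by_cases hq : ∃ q ∈ W, G.Adj r q ∧ q ≠ z
  · obtain ⟨q, hq, hrq, hqz⟩ := hq
    have hcq : IsCore G W q := by
      by_cases hqy : q = y
      · exact hqy ▸ Or.inr hub
      · refine Or.inl (hy1 q hq ?_)
        by_contra h'
        exact hqz (huniq q (mem_play.2 ⟨hq, hqy, h'⟩) hrq)
    have h8 : 8 ≤ weight G W r := eight_le_weight ⟨q, z, hqz, hrq, hrz, hcq, Or.inr hzhub⟩
    have h6 := weight_le_six_of_unique hrW1 huniq
    exact hy3 r hrW (by omega)
  · push Not at hq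
    refine (stem_of_adj_hub H hzhub).2.2 r hrW ?_
    have := drop_five (W := W) (W' := play G W z) (x := r) (fun h => hrW (play_subset h))
      (fun t ht hrt => (mem_play.1 ht).2.1 (hq t (play_subset ht) hrt)) hzW hrz
    omega

end Hot

/-! ### Weak replies and gains in calm positions. -/

/-- Two adjacent undominated vertices without other undominated neighbors. -/
structure IsPair {V : Type*} (G : SimpleGraph V) (W : Finset V) (u w : V) : Prop where
  left_mem : u ∈ W
  right_mem : w ∈ W
  adj : G.Adj u w
  left_unique : ∀ t ∈ W, G.Adj u t → t = w
  right_unique : ∀ t ∈ W, G.Adj w t → t = u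

/-- A reply at `z` that dominates only `z` and gains little, when the undominated set is `W`. -/
def IsWeakReply {V : Type*} (G : SimpleGraph V) (W : Finset V) (r z : V) : Prop :=
  ((∀ t ∈ W, ¬ G.Adj z t) ∧ ∀ x, G.Adj z x → ∃ t ∈ W, t ≠ z ∧ G.Adj x t) ∨
    ((∃ t ∈ W, G.Adj z t) ∧ IsLeafAt G W r z ∧ ∀ x, IsLeafAt G W x z → x = r)

/-- Dominator has a strategy that gains enough over the next two or the next four moves. -/
def Payable {V : Type*} [Fintype V] (G : SimpleGraph V) (W : Finset V) : Prop :=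
  ∃ v, Legal G W v ∧ potential G (play G W v) + 16 ≤ potential G W ∧
    ∀ r, Legal G (play G W v) r →
      potential G (play G (play G W v) r) + 32 ≤ potential G W ∨
      ∃ v', Legal G (play G (play G W v) r) v' ∧
        potential G (play G (play G (play G W v) r) v') + 48 ≤ potential G W ∧
        ∀ r', Legal G (play G (play G (play G W v) r) v') r' →
          potential G (play G (play G (play G (play G W v) r) v') r') + 64 ≤ potential G W

section Calm

variable {V : Type*} {G : SimpleGraph V} {W W' : Finset V} {u v w x y z t a b c d p : V}

theorem IsPair.symm (h : IsPair G W u w) : IsPair G W w u :=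
  ⟨h.right_mem, h.left_mem, h.adj.symm, h.right_unique, h.left_unique⟩

theorem IsPair.mem_play_iff (h : IsPair G W u w) : x ∈ play G W u ↔ x ∈ W ∧ x ≠ u ∧ x ≠ w := by
  rw [DominationGame.mem_play]
  refine ⟨fun ⟨h1, h2, h3⟩ => ⟨h1, h2, ?_⟩, fun ⟨h1, h2, h3⟩ => ⟨h1, h2, fun h4 => ?_⟩⟩
  · rintro rfl
    exact h3 h.adj
  · exact h3 (h.left_unique x h1 h4)

theorem Calm.mono (hc : Calm G W) (hW : W' ⊆ W) : Calm G W' :=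
  fun u w y hu hw hy => hc u w y (hW hu) (hW hw) (hW hy)

theorem Calm.isStem_of_isCore (hc : Calm G W) (h : IsCore G W x) : IsStem G W x := by
  refine h.resolve_right fun h => ?_
  obtain ⟨hx, s, -, -, -, -, -, hs, -, -, ⟨hsW, l, hl, hls⟩, -⟩ := id h
  exact h.ne_of_unique hls (hc s l x hsW hl hx hls hs.symm)

/-- All cores are stems here, and an undominated neighbor of a stem is its leaf, which has no second
neighbor. Hence newly dominated vertices drop by 4, not just by 2. -/
theorem Calm.not_hasTwoCores (hc : Calm G W) (hx : x ∈ W) : ¬ HasTwoCores G W x := by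
  rintro ⟨a, b, hab, ha, hb, ca, cb⟩
  obtain ⟨haW, l, hl, hla⟩ := hc.isStem_of_isCore ca
  obtain rfl := hc a l x haW hl hx hla ha.symm
  exact hab ((hla b).1 hb).symm

theorem Calm.drop_four (hc : Calm G W) (hW : W' ⊆ W) (hx : x ∈ W) (hx' : x ∉ W') :
    weight G W' x + 4 ≤ weight G W x :=
  DominationGame.drop_four hx hx' fun h => hc.not_hasTwoCores hx (h.mono hW)

end Calm

section Moves

variable {V : Type*} [Fintype V] {G : SimpleGraph V} {W W' : Finset V}
  {u v w x y z t a b c d p q r : V}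

theorem drop_played {V : Type*} {G : SimpleGraph V} {W : Finset V} {v : V} (hv : v ∈ W) :
    weight G (play G W v) v + 10 ≤ weight G W v :=
  drop_ten hv (by simp [mem_play]) fun _ hz => (mem_play.1 hz).2.2

theorem Calm.gain_ten_of_legal (hc : Calm G W) (h : Legal G W v) :
    potential G (play G W v) + 10 ≤ potential G W := by
  have hv' : v ∉ play G W v := by simp [mem_play]
  have hv0 : ∀ z ∈ play G W v, ¬ G.Adj v z := fun z hz => (mem_play.1 hz).2.2
  by_cases hv : v ∈ W
  · exact gain_one play_subset (drop_played hv)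
  obtain ⟨x, hx, rfl | hvx⟩ := h
  · exact absurd hx hv
  have hx' : x ∉ play G W v := by simp [mem_play, hvx]
  have hne : [v, x].Nodup := by simp [hvx.ne]
  by_cases hiso : ∃ t ∈ W, G.Adj x t
  · obtain ⟨t, ht, hxt⟩ := hiso
    exact gain_two play_subset hne (drop_six_of_adj hv' hv0 hx ht hvx hxt)
      (hc.drop_four play_subset hx hx')
  · push Not at hiso
    have := gain_two play_subset hne (drop_five hv' hv0 hx hvx)
      (drop_ten hx hx' fun z hz => hiso z (play_subset hz))
    omega

/-- The basic gain is 10, or 6 + 4 at a dominated `r`. It reaches 14 with a second newly dominated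
vertex (4), with a neighbor of an isolated `r` that loses its last prospect (5), or with a second
leaf at `z` (6). -/
theorem Calm.weakReply_of_gain_lt (hc : Calm G W) (h : Legal G W r)
    (hlt : potential G W < potential G (play G W r) + 14) :
    ∃ z ∈ W, play G W r = W.erase z ∧ IsWeakReply G W r z := by
  have hr' : r ∉ play G W r := by simp [mem_play]
  have hr0 : ∀ z ∈ play G W r, ¬ G.Adj r z := fun z hz => (mem_play.1 hz).2.2
  by_cases hr : r ∈ W
  · have hiso : ∀ t ∈ W, ¬ G.Adj r t := fun t ht hrt => by
      have := gain_two play_subset (by simp [hrt.ne]) (drop_played hr)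
        (hc.drop_four play_subset ht (by simp [mem_play, hrt]))
      omega
    refine ⟨r, hr, ?_, Or.inl ⟨hiso, fun x hrx => ?_⟩⟩
    · ext x; rw [mem_play, Finset.mem_erase]; grind
    · by_contra! hx
      have hxW : x ∉ W := fun h => hiso x h hrx
      have := gain_two play_subset (by simp [hrx.ne]) (drop_played hr)
        (drop_five (x := x) (fun h => hxW (play_subset h)) (fun z hz => hx z (play_subset hz)
          (mem_play.1 hz).2.1) hr hrx.symm)
      omega
  obtain ⟨z, hz, rfl | hrz⟩ := h
  · exact absurd hz hr
  have hz' : z ∉ play G W r := by simp [mem_play, hrz]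
  have hziso : ∃ t ∈ W, G.Adj z t := by
    by_contra! h
    have := gain_two play_subset (by simp [hrz.ne]) (drop_five hr' hr0 hz hrz)
      (drop_ten hz hz' fun t ht => h t (play_subset ht))
    omega
  obtain ⟨t, ht, hzt⟩ := id hziso
  have hr6 := drop_six_of_adj hr' hr0 hz ht hrz hzt
  have hz4 := hc.drop_four play_subset hz hz'
  have huniq : ∀ q ∈ W, G.Adj r q → q = z := by
    intro q hq hrq
    by_contra hqz
    have := gain_three (a := r) (b := z) (c := q) play_subset
      (by simp; grind [hrz.ne, hrq.ne]) hr6 hz4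
      (hc.drop_four play_subset hq (by simp [mem_play, hrq]))
    omega
  have hplay : play G W r = W.erase z := by
    ext x; rw [mem_play, Finset.mem_erase]; grind
  refine ⟨z, hz, hplay, Or.inr ⟨hziso, ⟨hr, hz, hrz, huniq⟩, fun x hx => ?_⟩⟩
  by_contra hxr
  have := gain_three (a := r) (b := z) (c := x) play_subset
    (by simp; grind [hrz.ne, hx.2.2.1.ne]) hr6 hz4
    (drop_six_of_adj (fun h => hx.1 (play_subset h)) (fun q hq hxq => hz' (hx.2.2.2 q
      (play_subset hq) hxq ▸ hq)) hz ht hx.2.2.1 hzt)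
  omega

/-- Since 18 + 14 = 32, only weak replies need an answer. -/
theorem Calm.payable_of_gain_of_replies (hc : Calm G W) (v : V)
    (hv : potential G (play G W v) + 18 ≤ potential G W)
    (h : ∀ r z, z ∈ play G W v → play G (play G W v) r = (play G W v).erase z →
      IsWeakReply G (play G W v) r z →
      potential G ((play G W v).erase z) + 32 ≤ potential G W ∨
      ∃ v', Legal G ((play G W v).erase z) v' ∧
        potential G (play G ((play G W v).erase z) v') + 48 ≤ potential G W ∧
        ∀ r', Legal G (play G ((play G W v).erase z) v') r' →
          potential G (play G (play G ((play G W v).erase z) v') r') + 64 ≤ potential G W) :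
    Payable G W := by
  have hc1 := hc.mono (play_subset (G := G) (v := v))
  refine ⟨v, legal_of_gain (i := 17) hv, by omega, fun r hr => ?_⟩
  by_cases h14 : potential G (play G (play G W v) r) + 14 ≤ potential G (play G W v)
  · left; omega
  obtain ⟨z, hz, hp, hw⟩ := hc1.weakReply_of_gain_lt hr (by omega)
  have h := h r z hz hp hw
  rwa [← hp] at h

/-- Here `m` is the potential before the round: 54 after three moves leaves only 10 for the last
reply. -/
theorem Calm.legal_and_of_gain (hc : Calm G W) {n : ℕ} (h24 : 24 ≤ n)
    (hv : potential G (play G W v) + n ≤ potential G W) {m : ℕ}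
    (hm : potential G W + (54 - n) ≤ m) : Legal G W v ∧ potential G (play G W v) + 48 ≤ m ∧
      ∀ r, Legal G (play G W v) r → potential G (play G (play G W v) r) + 64 ≤ m := by
  refine ⟨legal_of_gain (i := n - 1) (by omega), by omega, fun r hr => ?_⟩
  have := (hc.mono play_subset).gain_ten_of_legal hr
  omega

/-- The budget is `g + 10 + (44 - g) = 54` before the last reply. -/
theorem Calm.payable_of_gain (hc : Calm G W) {g : ℕ} (hg : 18 ≤ g) (hg' : g ≤ 20) (v : V)
    (hv : potential G (play G W v) + g ≤ potential G W)
    (h : ∀ r z, z ∈ play G W v → play G (play G W v) r = (play G W v).erase z →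
      IsWeakReply G (play G W v) r z →
      potential G ((play G W v).erase z) + 32 ≤ potential G W ∨
      ∃ v', potential G (play G ((play G W v).erase z) v') + (44 - g) ≤
        potential G ((play G W v).erase z)) : Payable G W := by
  have hc1 := hc.mono (play_subset (G := G) (v := v))
  refine hc.payable_of_gain_of_replies v (by omega) fun r z hz hp hw => ?_
  have h10 := hc1.gain_ten_of_legal (v := r) (by
    by_contra hr
    have : z ∈ play G (play G W v) r := mem_play.2 ⟨hz, by
      simp only [Legal, not_exists, not_and, not_or] at hr
      exact hr z hz⟩
    rw [hp] at this
    exact Finset.notMem_erase _ _ this)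
  rw [hp] at h10
  refine (h r z hz hp hw).imp_right ?_
  rintro ⟨v', hv'⟩
  exact ⟨v', (hc1.mono (Finset.erase_subset _ _)).legal_and_of_gain (by omega) hv' (by omega)⟩

theorem Calm.payable_of_gain_large (hc : Calm G W)
    (hv : potential G (play G W v) + 22 ≤ potential G W) : Payable G W := by
  refine ⟨v, legal_of_gain (i := 21) (by omega), by omega, fun r hr => Or.inl ?_⟩
  have := (hc.mono play_subset).gain_ten_of_legal hr
  omega

theorem Calm.gain_of_end (hc : Calm G W) (hv : v ∈ W) (ha : a ∈ W) (hb : b ∈ W)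
    (hva : G.Adj v a) (hvb : G.Adj v b) (hab : b ≠ a) (hau : ∀ t ∈ W, G.Adj a t → t = v) :
    potential G (play G W v) + 24 ≤ potential G W := by
  exact gain_three (a := v) (b := a) (c := b) play_subset
    (by simp; grind [hva.ne, hvb.ne]) (drop_played hv)
    (drop_ten ha (by simp [mem_play, hva]) fun t ht h =>
      (mem_play.1 ht).2.1 (hau t (play_subset ht) h))
    (hc.drop_four play_subset hb (by simp [mem_play, hvb]))

theorem gain_of_end_leaf (hv : v ∈ W) (ha : a ∈ W)
    (hva : G.Adj v a) (hau : ∀ t ∈ W, G.Adj a t → t = v) (hx : IsLeafAt G W x a) :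
    potential G (play G W v) + 26 ≤ potential G W := by
  exact gain_three (a := v) (b := a) (c := x) play_subset
    (by simp; grind [hva.ne, hx.2.2.1.ne, hx.1]) (drop_played hv)
    (drop_ten ha (by simp [mem_play, hva]) fun t ht h =>
      (mem_play.1 ht).2.1 (hau t (play_subset ht) h))
    (drop_six_of_adj (fun h => hx.1 (play_subset h)) (fun t ht hxt => by
      obtain rfl := hx.2.2.2 t (play_subset ht) hxt
      exact (mem_play.1 ht).2.2 hva) ha hv hx.2.2.1 hva.symm)

/-- With two undominated neighbors of `z`, playing `z` gains 10 + 4 + 4 + 6; with `t` alone, playing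
`t` clears `z` and the leaf as well. -/
theorem Calm.exists_gain_of_leaf (hc : Calm G W) (hx : IsLeafAt G W x z) (ht : t ∈ W)
    (hzt : G.Adj z t) : ∃ v, potential G (play G W v) + 24 ≤ potential G W := by
  by_cases h : ∃ s ∈ W, G.Adj z s ∧ s ≠ t
  · obtain ⟨s, hs, hzs, hst⟩ := h
    refine ⟨z, gain_four (a := z) (b := t) (c := s) (d := x) play_subset
      (by simp; grind [hzt.ne, hzs.ne, hx.2.2.1.ne, hx.1]) (drop_played hx.2.1)
      (hc.drop_four play_subset ht (by simp [mem_play, hzt]))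
      (hc.drop_four play_subset hs (by simp [mem_play, hzs]))
      (drop_six_of_adj (fun h => hx.1 (play_subset h)) (fun q hq hxq =>
        (mem_play.1 hq).2.1 (hx.2.2.2 q (play_subset hq) hxq)) hx.2.1 ht hx.2.2.1 hzt)⟩
  · push Not at h
    have := gain_of_end_leaf (v := t) ht hx.2.1 hzt.symm h hx
    exact ⟨t, by omega⟩

theorem gain_of_two_isolated (hy : y ∉ W) (ha : a ∈ W) (hb : b ∈ W) (hab : a ≠ b)
    (hya : G.Adj y a) (hyb : G.Adj y b) (ha' : ∀ t ∈ W, ¬ G.Adj a t)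
    (hb' : ∀ t ∈ W, ¬ G.Adj b t) : potential G (play G W y) + 26 ≤ potential G W := by
  exact gain_three (a := y) (b := a) (c := b) play_subset
    (by simp; grind [hya.ne, hyb.ne])
    (drop_six_of_ne (fun h => hy (play_subset h)) (fun z hz => (mem_play.1 hz).2.2) ha hb hab
      hya hyb)
    (drop_ten ha (by simp [mem_play, hya]) fun t ht => ha' t (play_subset ht))
    (drop_ten hb (by simp [mem_play, hyb]) fun t ht => hb' t (play_subset ht))

theorem Calm.gain_of_isolated (hc : Calm G W) (hy : y ∉ W) (ha : a ∈ W) (hb : b ∈ W)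
    (hd : d ∈ W) (hab : a ≠ b) (had : a ≠ d) (hbd : b ≠ d)
    (hya : G.Adj y a) (hyb : G.Adj y b) (hyd : G.Adj y d) (ha' : ∀ t ∈ W, ¬ G.Adj a t) :
    potential G (play G W y) + 24 ≤ potential G W := by
  exact gain_four (a := y) (b := a) (c := b) (d := d) play_subset
    (by simp; grind [hya.ne, hyb.ne, hyd.ne])
    (drop_six_of_ne (fun h => hy (play_subset h)) (fun z hz => (mem_play.1 hz).2.2) ha hb hab
      hya hyb)
    (drop_ten ha (by simp [mem_play, hya]) fun t ht => ha' t (play_subset ht))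
    (hc.drop_four play_subset hb (by simp [mem_play, hyb]))
    (hc.drop_four play_subset hd (by simp [mem_play, hyd]))

end Moves

/-! ### Structure of critical positions. -/

section Critical

variable {V : Type*} [Fintype V] {G : SimpleGraph V} {W : Finset V}
  {u v w x y z t a b c d p q r : V}

/-- A calm position in which no move of Dominator pays for itself and the next move. -/
structure Critical {V : Type*} [Fintype V] (G : SimpleGraph V) (W : Finset V) : Prop where
  calm : Calm G W
  lt_gain : ∀ v, potential G W < potential G (play G W v) + 22

theorem Critical.not_adj_of_leaf (h : Critical G W) (hx : IsLeafAt G W x z) (ht : t ∈ W) :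
    ¬ G.Adj z t := fun hzt => by
  obtain ⟨v, hv⟩ := h.calm.exists_gain_of_leaf hx ht hzt
  have := h.lt_gain v
  omega

/-- A third neighbor would give 10 + 3 · 4 = 22. With `Critical.isPair_of_unique` and
`Critical.not_triangle`, this leaves isolated vertices, single edges and cycles of length at least
four as components. -/
theorem Critical.eq_of_adj (h : Critical G W) (hx : x ∈ W) (ha : a ∈ W) (hb : b ∈ W) (hc : c ∈ W)
    (hxa : G.Adj x a) (hxb : G.Adj x b) (hxc : G.Adj x c) (hab : a ≠ b) : c = a ∨ c = b := by
  by_contra! hne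
  have := gain_four (a := x) (b := a) (c := b) (d := c) play_subset
    (by simp; grind [hxa.ne, hxb.ne, hxc.ne]) (drop_played hx)
    (h.calm.drop_four play_subset ha (by simp [mem_play, hxa]))
    (h.calm.drop_four play_subset hb (by simp [mem_play, hxb]))
    (h.calm.drop_four play_subset hc (by simp [mem_play, hxc]))
  have := h.lt_gain x
  omega

theorem Critical.isPair_of_unique (h : Critical G W) (hv : v ∈ W) (ha : a ∈ W)
    (hva : G.Adj v a) (hau : ∀ t ∈ W, G.Adj a t → t = v) : IsPair G W v a := by
  refine ⟨hv, ha, hva, fun t ht hvt => ?_, hau⟩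
  by_contra hta
  have := h.calm.gain_of_end hv ha ht hva hvt hta hau
  have := h.lt_gain v
  omega

theorem Critical.not_triangle (h : Critical G W) (hx : x ∈ W) (ha : a ∈ W) (hb : b ∈ W)
    (hxa : G.Adj x a) (hxb : G.Adj x b) : ¬ G.Adj a b := fun hab => by
  have := gain_three (W' := play G W x) (a := x) (b := a) (c := b) play_subset
    (by simp; grind [hxa.ne, hxb.ne, hab.ne]) (drop_played hx)
    (drop_ten ha (by simp [mem_play, hxa]) fun t ht hat => by
      have := h.eq_of_adj ha hx hb (play_subset ht) hxa.symm hab hat hxb.ne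
      rw [mem_play] at ht; grind)
    (drop_ten hb (by simp [mem_play, hxb]) fun t ht hbt => by
      have := h.eq_of_adj hb hx ha (play_subset ht) hxb.symm hab.symm hbt hxa.ne
      rw [mem_play] at ht; grind)
  have := h.lt_gain x
  omega

theorem Critical.eq_of_isolated (h : Critical G W) (hy : y ∉ W) (ha : a ∈ W) (hb : b ∈ W)
    (hya : G.Adj y a) (hyb : G.Adj y b) (ha' : ∀ t ∈ W, ¬ G.Adj a t)
    (hb' : ∀ t ∈ W, ¬ G.Adj b t) : a = b := by
  by_contra hab
  have := gain_of_two_isolated hy ha hb hab hya hyb ha' hb'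
  have := h.lt_gain y
  omega

theorem Critical.eq_of_adj_isolated (h : Critical G W) (hy : y ∉ W) (ha : a ∈ W) (hb : b ∈ W)
    (hd : d ∈ W) (hya : G.Adj y a) (hyb : G.Adj y b) (hyd : G.Adj y d) (hba : b ≠ a)
    (ha' : ∀ t ∈ W, ¬ G.Adj a t) : d = a ∨ d = b := by
  by_contra! hne
  have := h.calm.gain_of_isolated hy ha hb hd hba.symm hne.1.symm hne.2.symm hya hyb hyd ha'
  have := h.lt_gain y
  omega

theorem Critical.eq_of_adj_dominated (h : Critical G W) (hy : y ∉ W) (ha : a ∈ W) (hb : b ∈ W)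
    (hc : c ∈ W) (hd : d ∈ W) (hya : G.Adj y a) (hyb : G.Adj y b) (hyc : G.Adj y c)
    (hyd : G.Adj y d) (hab : a ≠ b) (hac : a ≠ c) (hbc : b ≠ c) : d = a ∨ d = b ∨ d = c := by
  by_contra! hne
  have := gain_five (a := y) (b := a) (c := b) (d := c) (e := d) play_subset
    (by simp; grind [hya.ne, hyb.ne, hyc.ne, hyd.ne])
    (drop_six_of_ne (fun h => hy (play_subset h)) (fun z hz => (mem_play.1 hz).2.2) ha hb hab
      hya hyb)
    (h.calm.drop_four play_subset ha (by simp [mem_play, hya]))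
    (h.calm.drop_four play_subset hb (by simp [mem_play, hyb]))
    (h.calm.drop_four play_subset hc (by simp [mem_play, hyc]))
    (h.calm.drop_four play_subset hd (by simp [mem_play, hyd]))
  have := h.lt_gain y
  omega

theorem IsPair.gain (h : IsPair G W u w) : potential G (play G W u) + 20 ≤ potential G W :=
  gain_two play_subset (by simp [h.adj.ne]) (drop_played h.left_mem)
    (drop_ten h.right_mem (by simp [mem_play, h.adj]) fun t ht hwt =>
      (mem_play.1 ht).2.1 (h.right_unique t (play_subset ht) hwt))

/-- With a third undominated neighbor, playing `y` gains 6 + 10 + 10 + 4; without one, playing `u`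
clears `y` along with the pair. -/
theorem Critical.not_adj_pair (h : Critical G W) (hp : IsPair G W u w) (hy : y ∉ W)
    (hyu : G.Adj y u) : ¬ G.Adj y w := fun hyw => by
  by_cases hq : ∃ q ∈ W, G.Adj y q ∧ q ≠ u ∧ q ≠ w
  · obtain ⟨q, hq, hyq, hqu, hqw⟩ := hq
    have := gain_four (a := y) (b := u) (c := w) (d := q) play_subset
      (by simp; grind [hyu.ne, hyw.ne, hyq.ne, hp.adj.ne])
      (drop_six_of_ne (fun h => hy (play_subset h)) (fun z hz => (mem_play.1 hz).2.2) hp.left_mem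
        hp.right_mem hp.adj.ne hyu hyw)
      (drop_ten hp.left_mem (by simp [mem_play, hyu]) fun t ht hut => by
        obtain rfl := hp.left_unique t (play_subset ht) hut
        exact (mem_play.1 ht).2.2 hyw)
      (drop_ten hp.right_mem (by simp [mem_play, hyw]) fun t ht hwt => by
        obtain rfl := hp.right_unique t (play_subset ht) hwt
        exact (mem_play.1 ht).2.2 hyu)
      (h.calm.drop_four play_subset hq (by simp [mem_play, hyq]))
    have := h.lt_gain y
    omega
  · push Not at hq
    have := gain_three (a := u) (b := w) (c := y) play_subset
      (by simp; grind [hyu.ne, hyw.ne, hp.adj.ne]) (drop_played hp.left_mem)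
      (drop_ten hp.right_mem (by simp [mem_play, hp.adj]) fun t ht hwt =>
        (mem_play.1 ht).2.1 (hp.right_unique t (play_subset ht) hwt))
      (drop_six_of_ne (fun h => hy (play_subset h)) (fun t ht hyt => by
        rw [hp.mem_play_iff] at ht; exact ht.2.2 (hq t ht.1 hyt ht.2.1)) hp.left_mem
        hp.right_mem hp.adj.ne hyu hyw)
    have := h.lt_gain u
    omega

/-- The weight 8 is needed here: playing `u` gains 20 with its leaf, and the fall of `y` from 8 to 6
supplies the missing 2. -/
theorem Critical.not_stems (h : Critical G W) (hy : y ∉ W) (hyu : G.Adj y u) (hyz : G.Adj y z)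
    (huz : u ≠ z) (hyt : ∀ t ∈ W, G.Adj y t → t = u ∨ t = z) (hu : IsStem G W u) :
    ¬ IsStem G W z := fun hz => by
  obtain ⟨huW, w, hw, hwu⟩ := id hu
  have huw : G.Adj u w := ((hwu u).2 rfl).symm
  have h8 : 8 ≤ weight G W y := eight_le_weight ⟨u, z, huz, hyu, hyz, Or.inl hu, Or.inl hz⟩
  have h6 : weight G (play G W u) y ≤ 6 :=
    weight_le_six_of_unique (z := z) (fun h => hy (play_subset h)) fun t ht hyt' =>
      (hyt t (play_subset ht) hyt').resolve_left (mem_play.1 ht).2.1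
  have := gain_three (a := u) (b := w) (c := y) (k := 2) play_subset
    (by simp; grind [hyu.ne, huw.ne]) (drop_played huW)
    (drop_ten hw (by simp [mem_play, huw]) fun t ht hwt =>
      (mem_play.1 ht).2.1 ((hwu t).1 hwt)) (by omega)
  have := h.lt_gain u
  omega

/-- After one vertex of degree two is removed, a path with at least three vertices remains. -/
theorem Critical.exists_gain_of_erase (h : Critical G W) {W' : Finset V} (R : V → Prop)
    (hz : z ∈ W) (ha : a ∈ W) (hb : b ∈ W) (hza : G.Adj z a) (hzb : G.Adj z b) (hab : a ≠ b)
    (hR : ∀ s t, R s → t ∈ W → G.Adj s t → R t) (hzR : ¬ R z) (hW : W' ⊆ W) (hzW : z ∉ W')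
    (hW' : ∀ t ∈ W, t ≠ z → ¬ R t → t ∈ W') :
    ∃ v, potential G (play G W' v) + 24 ≤ potential G W' := by
  -- `R` is closed under adjacency within `W` and avoids `z`, so no vertex reached from `z` is lost
  -- with it.
  have haR : ¬ R a := fun h => hzR (hR a z h hz hza.symm)
  have ha' := hW' a ha hza.ne' haR
  obtain ⟨c, hc, hac, hcz⟩ : ∃ c ∈ W, G.Adj a c ∧ c ≠ z := by
    by_contra! h1
    exact hab ((h.isPair_of_unique hz ha hza h1).left_unique b hb hzb).symm
  have hcR : ¬ R c := fun h => haR (hR c a h ha hac.symm)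
  have hc' := hW' c hc hcz hcR
  obtain ⟨d, hd, hcd, hda⟩ : ∃ d ∈ W, G.Adj c d ∧ d ≠ a := by
    by_contra! h1
    exact hcz ((h.isPair_of_unique ha hc hac h1).left_unique z hz hza.symm).symm
  have hdR : ¬ R d := fun h => hcR (hR d c h hc hcd.symm)
  have hdz : d ≠ z := by
    rintro rfl
    exact h.not_triangle ha hd hc hza.symm hac hcd.symm
  refine ⟨c, (h.calm.mono hW).gain_of_end hc' ha' (hW' d hd hdz hdR) hac.symm hcd hda
    fun t ht hat => ?_⟩
  refine (h.eq_of_adj ha hz hc (hW ht) hza.symm hac hat hcz.symm).resolve_left ?_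
  rintro rfl
  exact hzW ht

end Critical

/-! ### Single edges. -/

/-- After Dominator clears the pair `q, q'`, Staller can use `y` to dominate `z` in another pair
`z, z'`, and no good move is left for Dominator. -/
structure BadReply {V : Type*} [Fintype V] (G : SimpleGraph V) (W : Finset V)
    (q q' y z z' : V) : Prop where
  pair : IsPair G W q q'
  pair' : IsPair G W z z'
  ne_left : z ≠ q
  ne_right : z ≠ q'
  notMem : y ∉ W
  adj_left : G.Adj y q
  adj_right : G.Adj y z
  eq_or_eq : ∀ t ∈ W, G.Adj y t → t = q ∨ t = z
  unique : ∀ x, x ∉ W → G.Adj x z → (∀ t ∈ W, G.Adj x t → t = q ∨ t = q' ∨ t = z) → x = y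
  lt_gain : ∀ W' : Finset V, (∀ t, t ∈ W' ↔ t ∈ W ∧ t ≠ q ∧ t ≠ q' ∧ t ≠ z) →
    potential G W < potential G W' + 32 ∧
      ∀ v, potential G W' < potential G (play G W' v) + 24

section Pair

variable {V : Type*} [Fintype V] {G : SimpleGraph V} {W : Finset V}
  {u w x y z z' q q' s : V}

/-- Clearing the pair gains 20, so some weak reply at a vertex `z` leaves no gain of 24. If `z` were
isolated, a neighbor of it would become a leaf at a vertex that is not; if `z` lay on a cycle, a
path would remain. So `z` is in a pair, and its leaf, which was none before, sees `u` or `w`. -/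
theorem Critical.exists_badReply (h : Critical G W) (hG : ∀ x, ∃ y, G.Adj x y)
    (hW : ¬ Payable G W) (hp : IsPair G W u w) :
    ∃ q q' y z z', (q = u ∧ q' = w ∨ q = w ∧ q' = u) ∧ BadReply G W q q' y z z' := by
  by_contra! hbad
  refine hW (h.calm.payable_of_gain (by norm_num) le_rfl u hp.gain ?_)
  intro r z hz hpl hweak
  have hzW := hp.mem_play_iff.1 hz
  by_contra! hcon
  obtain ⟨hcon1, hcon2⟩ := hcon
  have hadj : ∀ t ∈ W, t ≠ u → t ≠ w → ∀ s, G.Adj t s → s ≠ u ∧ s ≠ w := by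
    intro t ht htu htw s hts
    constructor
    · rintro rfl
      exact htw (hp.left_unique t ht hts.symm)
    · rintro rfl
      exact htu (hp.right_unique t ht hts.symm)
  have hW2 : (play G W u).erase z ⊆ W := (Finset.erase_subset _ _).trans play_subset
  have hm2 : ∀ t, t ∈ (play G W u).erase z ↔ t ∈ W ∧ t ≠ u ∧ t ≠ w ∧ t ≠ z := by
    intro t; rw [Finset.mem_erase, hp.mem_play_iff]; tauto
  rcases hweak with ⟨hzi, hzb⟩ | ⟨⟨t0, ht0, hzt0⟩, hr, hru⟩
  · obtain ⟨b, hzb'⟩ := hG z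
    obtain ⟨t, ht, htz, hbt⟩ := hzb b hzb'
    have htW := hp.mem_play_iff.1 ht
    have hziW : ∀ s ∈ W, ¬ G.Adj z s := fun s hs hzs =>
      hzi s (hp.mem_play_iff.2 ⟨hs, hadj z hzW.1 hzW.2.1 hzW.2.2 s hzs⟩) hzs
    have hbW : b ∉ W := fun hb => hziW b hb hzb'
    obtain ⟨s, hs, hts⟩ : ∃ s ∈ W, G.Adj t s := by
      by_contra! hti
      exact htz (h.eq_of_isolated hbW htW.1 hzW.1 hbt hzb'.symm hti hziW)
    have hsn := hadj t htW.1 htW.2.1 htW.2.2 s hts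
    have hleaf : IsLeafAt G ((play G W u).erase z) b t := by
      refine ⟨fun h => hbW (hW2 h), by rw [hm2]; tauto, hbt, fun q hq hbq => ?_⟩
      rw [hm2] at hq
      exact (h.eq_of_adj_isolated hbW hzW.1 htW.1 hq.1 hzb'.symm hbt hbq htz hziW).resolve_left
        hq.2.2.2
    obtain ⟨v, hv⟩ := (h.calm.mono hW2).exists_gain_of_leaf hleaf (t := s) (by
      rw [hm2]; exact ⟨hs, hsn.1, hsn.2, by rintro rfl; exact hziW t htW.1 hts.symm⟩) hts
    exact absurd (hcon2 v) (by omega)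
  · have hrW : r ∉ W := fun h' => by
      have := hadj z hzW.1 hzW.2.1 hzW.2.2 r hr.2.2.1.symm
      exact hr.1 (hp.mem_play_iff.2 ⟨h', this⟩)
    have hrn : ∀ t ∈ W, G.Adj r t → t = z ∨ t = u ∨ t = w := by
      intro t ht hrt
      by_contra! hne
      exact hne.1 (hr.2.2.2 t (hp.mem_play_iff.2 ⟨ht, hne.2⟩) hrt)
    have ht0W := hp.mem_play_iff.1 ht0
    have hpz : IsPair G W z t0 := by
      refine (h.isPair_of_unique ht0W.1 hzW.1 hzt0.symm fun t ht hzt => ?_).symm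
      by_contra htt
      obtain ⟨v, hv⟩ := h.exists_gain_of_erase (W' := (play G W u).erase z)
        (fun t => t = u ∨ t = w) hzW.1 ht0W.1 ht hzt0 hzt (Ne.symm htt)
        (by
          rintro s t (rfl | rfl) ht hst
          · exact Or.inr (hp.left_unique t ht hst)
          · exact Or.inl (hp.right_unique t ht hst)) (by tauto) hW2 (by simp)
        (fun t ht htz htR => by rw [hm2]; tauto)
      exact absurd (hcon2 v) (by omega)
    obtain ⟨q, hq, hrq, hqz⟩ : ∃ q ∈ W, G.Adj r q ∧ q ≠ z := by
      by_contra! h1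
      exact h.not_adj_of_leaf ⟨hrW, hzW.1, hr.2.2.1, h1⟩ ht0W.1 hzt0
    have key : ∀ q q', (q = u ∧ q' = w ∨ q = w ∧ q' = u) → IsPair G W q q' → G.Adj r q →
        False := by
      intro q q' hqq hpq hrq
      refine hbad q q' r z t0 hqq ⟨hpq, hpz, by grind, by grind, hrW, hrq, hr.2.2.1, ?_, ?_, ?_⟩
      · intro t ht hrt
        have h1 := h.not_adj_pair hpq hrW hrq
        rcases hrn t ht hrt with rfl | h2
        · exact Or.inr rfl
        · left
          by_contra htq
          have : t = q' := by grind
          exact h1 (this ▸ hrt)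
      · intro x hx hxz hxt
        refine hru x ⟨fun h' => hx (play_subset h'), hz, hxz, fun t ht hxt' => ?_⟩
        have htW := hp.mem_play_iff.1 ht
        have := hxt t htW.1 hxt'
        grind
      · intro W' hW'
        have : W' = (play G W u).erase z := by
          ext t; rw [hW', hm2]; grind
        subst this
        exact ⟨hcon1, hcon2⟩
    rcases hrn q hq hrq with h1 | rfl | rfl
    · exact hqz h1
    · exact key q w (by tauto) hp hrq
    · exact key q u (by tauto) hp.symm hrq

theorem BadReply.ne_left' (h : BadReply G W q q' y z z') : z' ≠ q := by
  rintro rfl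
  exact h.ne_right (h.pair.left_unique z h.pair'.left_mem h.pair'.adj.symm)

theorem BadReply.ne_right' (h : BadReply G W q q' y z z') : z' ≠ q' := by
  rintro rfl
  exact h.ne_left (h.pair.right_unique z h.pair'.left_mem h.pair'.adj.symm)

/-- A dominated vertex adjacent to the cleared pair and to exactly one other vertex, which is not
isolated, is the one used by Staller. -/
theorem BadReply.eq_of_adj (hc : Calm G W) (h : BadReply G W q q' y z z') (hx : x ∉ W)
    (hxq : G.Adj x q ∨ G.Adj x q') (hs : s ∈ W) (hxs : G.Adj x s) (hsq : s ≠ q) (hsq' : s ≠ q')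
    (hxt : ∀ t ∈ W, G.Adj x t → t = q ∨ t = q' ∨ t = s) {s' : V} (hs' : s' ∈ W)
    (hss' : G.Adj s s') : x = y := by
  by_contra hxy
  have hsz : s ≠ z := by
    rintro rfl
    exact hxy (h.unique x hx hxs hxt)
  set W' := ((W.erase q).erase q').erase z with hW'
  have hm : ∀ t, t ∈ W' ↔ t ∈ W ∧ t ≠ q ∧ t ≠ q' ∧ t ≠ z := by
    intro t; simp only [hW', Finset.mem_erase]; tauto
  have hWW : W' ⊆ W := fun t ht => ((hm t).1 ht).1
  obtain ⟨h1, h2⟩ := h.lt_gain W' hm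
  have hleaf : IsLeafAt G W' x s := by
    refine ⟨fun h' => hx (hWW h'), (hm s).2 ⟨hs, hsq, hsq', hsz⟩, hxs, fun t ht hxt' => ?_⟩
    rw [hm] at ht
    have := hxt t ht.1 hxt'
    tauto
  have hqW : q ∉ W' := by simp [hm]
  have hqW' : q' ∉ W' := by simp [hm]
  have hzW : z ∉ W' := by simp [hm]
  -- If `s = z'`, then `x` and `z` become twins at `s`: the pair gives 20, `y` gives 6, `z` gives 5
  -- and `x` gives 1, in total 32.
  by_cases hsz' : s = z'
  · subst hsz'
    have hleafz : IsLeafAt G W' z s := by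
      refine ⟨hzW, hleaf.2.1, h.pair'.adj, fun t ht hzt => h.pair'.left_unique t (hWW ht) hzt⟩
    have hiso : ∀ t ∈ W', ¬ G.Adj s t := fun t ht hst => by
      obtain rfl := h.pair'.right_unique t (hWW ht) hst
      exact hzW ht
    have hxz : x ≠ z := fun h' => hx (h' ▸ h.pair'.left_mem)
    have hz5 := weight_le_five hleafz hleaf hxz hiso
    have hx5 := weight_le_five hleaf hleafz hxz.symm hiso
    have hz10 := weight_of_mem (G := G) h.pair'.left_mem
    have hx6 : 6 ≤ weight G W x := by
      rcases hxq with hxq | hxq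
      · exact six_le_weight_of_ne h.pair.left_mem hs hsq.symm hxq hxs
      · exact six_le_weight_of_ne h.pair.right_mem hs hsq'.symm hxq hxs
    have := gain_five (a := q) (b := q') (c := y) (d := z) (e := x) (l := 5) (m := 1) hWW
      (by
        have := h.pair.left_mem
        have := h.pair.right_mem
        have := h.pair.adj.ne
        have := h.pair'.left_mem
        have := h.notMem
        have := h.ne_left
        have := h.ne_right
        simp; grind)
      (drop_ten h.pair.left_mem hqW fun t ht hqt => hqW' (h.pair.left_unique t (hWW ht) hqt ▸ ht))
      (drop_ten h.pair.right_mem hqW' fun t ht hqt => hqW (h.pair.right_unique t (hWW ht) hqt ▸ ht))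
      (drop_six_of_ne (fun h' => h.notMem (hWW h')) (fun t ht hyt => by
        rcases h.eq_or_eq t (hWW ht) hyt with rfl | rfl
        · exact hqW ht
        · exact hzW ht) h.pair.left_mem h.pair'.left_mem h.ne_left.symm h.adj_left h.adj_right)
      (by omega) (by omega)
    omega
  · obtain ⟨v, hv⟩ := (hc.mono hWW).exists_gain_of_leaf hleaf (t := s') (by
      rw [hm]
      refine ⟨hs', ?_, ?_, ?_⟩
      · rintro rfl
        exact hsq' (h.pair.left_unique s hs hss'.symm)
      · rintro rfl
        exact hsq (h.pair.right_unique s hs hss'.symm)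
      · rintro rfl
        exact hsz' (h.pair'.left_unique s hs hss'.symm)) hss'
    exact absurd (h2 v) (by omega)

/-- As `q` is no stem via `q'`, there is a dominated neighbor `x ≠ q` of `q'`. If `x` sees `z`, it
is a leaf after the first bad reply, which allows a gain of 24; if it sees neither `z` nor `z'`,
playing it after the second bad reply gains 24. Both are contradictory. If it sees `z'`, Dominator
opens with `x`. -/
theorem Critical.payable_of_badReply (h : Critical G W) (h1 : BadReply G W q q' y z z')
    (h2 : BadReply G W z z' y q q') (hq : ¬ IsStem G W q) : Payable G W := by
  have hqW := h1.pair.left_mem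
  have hqW' := h1.pair.right_mem
  have hzW := h1.pair'.left_mem
  have hzW' := h1.pair'.right_mem
  obtain ⟨x, hqx, hxq⟩ : ∃ x, G.Adj q' x ∧ x ≠ q := by
    by_contra! hcon
    refine hq ⟨hqW, q', hqW', fun t => ⟨hcon t, ?_⟩⟩
    rintro rfl
    exact h1.pair.adj.symm
  have hx : x ∉ W := fun h' => hxq (h1.pair.right_unique x h' hqx)
  have hxq1 : ¬ G.Adj x q := fun h' => h.not_adj_pair h1.pair hx h' hqx.symm
  have hxy : x ≠ y := by
    rintro rfl
    exact hxq1 h1.adj_left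
  have third : ∀ s ∈ W, G.Adj x s → s ≠ q' → (∃ s' ∈ W, G.Adj s s') →
      ∃ t ∈ W, G.Adj x t ∧ t ≠ q ∧ t ≠ q' ∧ t ≠ s := by
    rintro s hs hxs hsq' ⟨s', hs', hss'⟩
    by_contra! hcon
    refine hxy (h1.eq_of_adj h.calm hx (Or.inr hqx.symm) hs hxs ?_ hsq' ?_ hs' hss')
    · rintro rfl
      exact hxq1 hxs
    · intro t ht hxt
      have := hcon t ht hxt
      tauto
  by_cases hxz : G.Adj x z
  · obtain ⟨p, hp, hxp, hpq, hpq', hpz⟩ := third z hzW hxz h1.ne_right ⟨z', hzW', h1.pair'.adj⟩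
    have hpz' : p ≠ z' := by
      rintro rfl
      exact h.not_adj_pair h1.pair' hx hxz hxp
    obtain ⟨s, hs, hps⟩ : ∃ s ∈ W, G.Adj p s := by
      by_contra! hpi
      have := h.eq_of_adj_isolated hx hp hqW' hzW hxp hqx.symm hxz hpq'.symm hpi
      exact this.elim hpz.symm h1.ne_right
    exfalso
    set W' := ((W.erase q).erase q').erase z with hW'
    have hm : ∀ t, t ∈ W' ↔ t ∈ W ∧ t ≠ q ∧ t ≠ q' ∧ t ≠ z := by
      intro t; simp only [hW', Finset.mem_erase]; tauto
    have hWW : W' ⊆ W := fun t ht => ((hm t).1 ht).1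
    have hleaf : IsLeafAt G W' x p := by
      refine ⟨fun h' => hx (hWW h'), (hm p).2 ⟨hp, hpq, hpq', hpz⟩, hxp, fun t ht hxt => ?_⟩
      rw [hm] at ht
      have := h.eq_of_adj_dominated hx hqW' hzW hp ht.1 hqx.symm hxz hxp hxt h1.ne_right.symm
        hpq'.symm hpz.symm
      tauto
    obtain ⟨v, hv⟩ := (h.calm.mono hWW).exists_gain_of_leaf hleaf (t := s) (by
      rw [hm]
      refine ⟨hs, ?_, ?_, ?_⟩
      · rintro rfl
        exact hpq' (h1.pair.left_unique p hp hps.symm)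
      · rintro rfl
        exact hpq (h1.pair.right_unique p hp hps.symm)
      · rintro rfl
        exact hpz' (h1.pair'.left_unique p hp hps.symm)) hps
    exact absurd ((h1.lt_gain W' hm).2 v) (by omega)
  by_cases hxz' : G.Adj x z'
  · obtain ⟨p, hp, hxp, hpq, hpq', hpz'⟩ :=
      third z' hzW' hxz' h1.ne_right' ⟨z, hzW, h1.pair'.adj.symm⟩
    have hpz : p ≠ z := by
      rintro rfl
      exact hxz hxp
    have hgain := gain_four (W' := play G W x) (a := x) (b := q') (c := z') (d := p) play_subset
      (by simp; grind [hqx.ne, hxz'.ne, hxp.ne, h1.ne_right'])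
      (drop_six_of_ne (fun h => hx (play_subset h)) (fun z hz => (mem_play.1 hz).2.2) hqW' hzW'
        h1.ne_right'.symm hqx.symm hxz')
      (h.calm.drop_four play_subset hqW' (by simp [mem_play, hqx.symm]))
      (h.calm.drop_four play_subset hzW' (by simp [mem_play, hxz']))
      (h.calm.drop_four play_subset hp (by simp [mem_play, hxp]))
    have hqiso : ∀ t ∈ play G W x, ¬ G.Adj q t := fun t ht hqt => by
      obtain rfl := h1.pair.left_unique t (play_subset ht) hqt
      exact (mem_play.1 ht).2.2 hqx.symm
    have hziso : ∀ t ∈ play G W x, ¬ G.Adj z t := fun t ht hqt => by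
      obtain rfl := h1.pair'.left_unique t (play_subset ht) hqt
      exact (mem_play.1 ht).2.2 hxz'
    -- A weak reply can dominate neither `q` nor `z`, now isolated; `y` then takes both for 26 = 44
    -- - 18.
    refine h.calm.payable_of_gain (g := 18) le_rfl (by norm_num) x (by omega) ?_
    intro r e he hpl hweak
    have heq : e ≠ q := by
      rintro rfl
      rcases hweak with ⟨-, hb⟩ | ⟨⟨t, ht, het⟩, -⟩
      · obtain ⟨t, ht, hte, hqt⟩ := hb q' h1.pair.adj
        exact hte (h1.pair.right_unique t (play_subset ht) hqt)
      · exact hqiso t ht het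
    have hez : e ≠ z := by
      rintro rfl
      rcases hweak with ⟨-, hb⟩ | ⟨⟨t, ht, het⟩, -⟩
      · obtain ⟨t, ht, hte, hqt⟩ := hb z' h1.pair'.adj
        exact hte (h1.pair'.right_unique t (play_subset ht) hqt)
      · exact hziso t ht het
    refine Or.inr ⟨y, gain_of_two_isolated (a := q) (b := z)
      (fun h' => h1.notMem (play_subset (Finset.mem_of_mem_erase h'))) ?_ ?_ h1.ne_left.symm
      h1.adj_left h1.adj_right (fun t ht => hqiso t (Finset.mem_of_mem_erase ht))
      (fun t ht => hziso t (Finset.mem_of_mem_erase ht))⟩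
    · exact Finset.mem_erase.2 ⟨heq.symm, mem_play.2 ⟨hqW, hxq.symm, hxq1⟩⟩
    · exact Finset.mem_erase.2 ⟨hez.symm, mem_play.2 ⟨hzW, by grind, hxz⟩⟩
  · exfalso
    obtain ⟨p, hp, hxp, hpq'⟩ : ∃ p ∈ W, G.Adj x p ∧ p ≠ q' := by
      by_contra! hcon
      exact h.not_adj_of_leaf ⟨hx, hqW', hqx.symm, hcon⟩ hqW h1.pair.adj.symm
    set W' := ((W.erase z).erase z').erase q with hW'
    have hm : ∀ t, t ∈ W' ↔ t ∈ W ∧ t ≠ z ∧ t ≠ z' ∧ t ≠ q := by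
      intro t; simp only [hW', Finset.mem_erase]; tauto
    have hWW : W' ⊆ W := fun t ht => ((hm t).1 ht).1
    have hmem : ∀ t ∈ W, G.Adj x t → t ∈ W' := by
      intro t ht hxt
      rw [hm]
      refine ⟨ht, ?_, ?_, ?_⟩ <;> rintro rfl <;> contradiction
    have hqiso : ∀ t ∈ W', ¬ G.Adj q' t := fun t ht hqt => by
      obtain rfl := h1.pair.right_unique t (hWW ht) hqt
      exact ((hm t).1 ht).2.2.2 rfl
    have hxW' : x ∉ W' := fun h' => hx (hWW h')
    have hlt := (h2.lt_gain W' hm).2 x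
    by_cases hpi : ∃ s ∈ W, G.Adj p s
    · obtain ⟨t, ht, hxt, htq, htq', htp⟩ := third p hp hxp hpq' hpi
      have := (h.calm.mono hWW).gain_of_isolated hxW' (hmem q' hqW' hqx.symm) (hmem p hp hxp)
        (hmem t ht hxt) hpq'.symm htq'.symm htp.symm hqx.symm hxp hxt hqiso
      omega
    · push Not at hpi
      have := gain_of_two_isolated hxW' (hmem q' hqW' hqx.symm) (hmem p hp hxp) hpq'.symm
        hqx.symm hxp hqiso fun t ht => hpi t (hWW ht)
      omega

/-- Opening instead with the pair hit by Staller leads to a bad reply with the same `y`, back at the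
first pair. Since `y` cannot join two stems, `payable_of_badReply` applies in one of the two orders.
-/
theorem Critical.payable_of_pair (h : Critical G W) (hG : ∀ x, ∃ y, G.Adj x y)
    (hp : IsPair G W u w) : Payable G W := by
  by_contra hW
  obtain ⟨q, q', y, z, z', -, h1⟩ := h.exists_badReply hG hW hp
  obtain ⟨p, p', y', s, s', hpz, h2⟩ := h.exists_badReply hG hW h1.pair'
  have hqW := h1.pair.left_mem
  have hyy : y = y' := by
    refine h2.eq_of_adj h.calm h1.notMem ?_ hqW h1.adj_left ?_ ?_ ?_ h1.pair.right_mem h1.pair.adj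
    · rcases hpz with ⟨rfl, rfl⟩ | ⟨rfl, rfl⟩
      · exact Or.inl h1.adj_right
      · exact Or.inr h1.adj_right
    · grind [h1.ne_left, h1.ne_left']
    · grind [h1.ne_left, h1.ne_left']
    · intro t ht hyt
      have := h1.eq_or_eq t ht hyt
      grind
  subst hyy
  have hpz' : p = z := by
    have := h1.eq_or_eq p h2.pair.left_mem h2.adj_left
    grind [h1.ne_left, h1.ne_left']
  have hpz'' : p' = z' := by
    have := h1.pair'.adj.ne
    grind
  subst hpz' hpz''
  have hsq : s = q := (h1.eq_or_eq s h2.pair'.left_mem h2.adj_right).resolve_right h2.ne_left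
  subst hsq
  have hsq' : s' = q' := h1.pair.left_unique s' h2.pair'.right_mem h2.pair'.adj
  subst hsq'
  by_cases hs : IsStem G W s
  · refine hW (h.payable_of_badReply h2 h1 ?_)
    exact h.not_stems h1.notMem h1.adj_left h1.adj_right h1.ne_left.symm h1.eq_or_eq hs
  · exact hW (h.payable_of_badReply h1 h2 hs)

end Pair

/-! ### Cycles of length four and at least six. -/

/-- An induced cycle of length five forming a component of the undominated vertices. -/
structure IsPentagon {V : Type*} (G : SimpleGraph V) (W : Finset V) (p a b c d : V) : Prop where
  mem₁ : p ∈ W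
  mem₂ : a ∈ W
  mem₃ : b ∈ W
  mem₄ : c ∈ W
  mem₅ : d ∈ W
  adj₁ : G.Adj p a
  adj₂ : G.Adj a b
  adj₃ : G.Adj b c
  adj₄ : G.Adj c d
  adj₅ : G.Adj d p
  eq₁ : ∀ t ∈ W, G.Adj p t → t = a ∨ t = d
  eq₂ : ∀ t ∈ W, G.Adj a t → t = p ∨ t = b
  eq₃ : ∀ t ∈ W, G.Adj b t → t = a ∨ t = c
  eq₄ : ∀ t ∈ W, G.Adj c t → t = b ∨ t = d
  eq₅ : ∀ t ∈ W, G.Adj d t → t = c ∨ t = p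
  nodup : [p, a, b, c, d].Nodup

theorem IsPentagon.symm {V : Type*} {G : SimpleGraph V} {W : Finset V} {p a b c d : V}
    (h : IsPentagon G W p a b c d) : IsPentagon G W p d c b a := by
  obtain ⟨h1, h2, h3, h4, h5, e1, e2, e3, e4, e5, f1, f2, f3, f4, f5, hn⟩ := h
  refine ⟨h1, h5, h4, h3, h2, e5.symm, e4.symm, e3.symm, e2.symm, e1.symm, ?_, ?_, ?_, ?_, ?_, ?_⟩
  · exact fun t ht h => (f1 t ht h).symm
  · exact fun t ht h => (f5 t ht h).symm
  · exact fun t ht h => (f4 t ht h).symm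
  · exact fun t ht h => (f3 t ht h).symm
  · exact fun t ht h => (f2 t ht h).symm
  · simp at hn ⊢; grind

section Cycle

variable {V : Type*} [Fintype V] {G : SimpleGraph V} {W : Finset V}
  {p a b c d e f u v w x y z s t : V}

theorem Critical.exists_ne (h : Critical G W) (hno : ∀ u w, ¬ IsPair G W u w) (hz : z ∈ W)
    (ht : t ∈ W) (hzt : G.Adj z t) : ∃ s ∈ W, G.Adj z s ∧ s ≠ t := by
  by_contra! hcon
  exact hno _ _ (h.isPair_of_unique ht hz hzt.symm hcon)

theorem Critical.mem_play_iff (h : Critical G W) (hp : p ∈ W) (ha : a ∈ W) (hd : d ∈ W)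
    (hpa : G.Adj p a) (hpd : G.Adj p d) (had : a ≠ d) :
    t ∈ play G W p ↔ t ∈ W ∧ t ≠ p ∧ t ≠ a ∧ t ≠ d := by
  rw [mem_play]
  constructor
  · rintro ⟨h1, h2, h3⟩
    refine ⟨h1, h2, ?_, ?_⟩ <;> rintro rfl <;> contradiction
  · rintro ⟨h1, h2, h3, h4⟩
    refine ⟨h1, h2, fun h5 => ?_⟩
    have := h.eq_of_adj hp ha hd h1 hpa hpd h5 had
    tauto

/-- Playing `p` isolates the opposite vertex `b` and makes `a`, `d` twins at it: 10 + 5 + 5 = 20, so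
a second gain of 24 suffices. -/
theorem Critical.payable_of_square (h : Critical G W) (hG : ∀ x, ∃ y, G.Adj x y)
    (hno : ∀ u w, ¬ IsPair G W u w) (hp : p ∈ W) (ha : a ∈ W) (hd : d ∈ W) (hb : b ∈ W)
    (hpa : G.Adj p a) (hpd : G.Adj p d) (hba : G.Adj b a) (hbd : G.Adj b d) (had : a ≠ d)
    (hpb : p ≠ b) : Payable G W := by
  have hm : ∀ t, t ∈ play G W p ↔ t ∈ W ∧ t ≠ p ∧ t ≠ a ∧ t ≠ d :=
    fun t => h.mem_play_iff hp ha hd hpa hpd had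
  have na : ∀ t ∈ W, G.Adj a t → t = p ∨ t = b := fun t ht hat =>
    h.eq_of_adj ha hp hb ht hpa.symm hba.symm hat hpb
  have nd : ∀ t ∈ W, G.Adj d t → t = p ∨ t = b := fun t ht hat =>
    h.eq_of_adj hd hp hb ht hpd.symm hbd.symm hat hpb
  have nb : ∀ t ∈ W, G.Adj b t → t = a ∨ t = d := fun t ht hat =>
    h.eq_of_adj hb ha hd ht hba hbd hat had
  have np : ∀ t ∈ W, G.Adj p t → t = a ∨ t = d := fun t ht hat =>
    h.eq_of_adj hp ha hd ht hpa hpd hat had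
  have hbm : b ∈ play G W p := (hm b).2 ⟨hb, hpb.symm, hba.ne, hbd.ne⟩
  have la : IsLeafAt G (play G W p) a b := by
    refine ⟨by simp [hm], hbm, hba.symm, fun t ht hat => ?_⟩
    rw [hm] at ht
    have := na t ht.1 hat
    tauto
  have ld : IsLeafAt G (play G W p) d b := by
    refine ⟨by simp [hm], hbm, hbd.symm, fun t ht hat => ?_⟩
    rw [hm] at ht
    have := nd t ht.1 hat
    tauto
  have hbi : ∀ t ∈ play G W p, ¬ G.Adj b t := fun t ht hbt => by
    rw [hm] at ht
    have := nb t ht.1 hbt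
    tauto
  have hgain := gain_three (W' := play G W p) (a := p) (b := a) (c := d) (j := 5) (k := 5)
    play_subset (by simp; grind [hpa.ne, hpd.ne]) (drop_played hp)
    (by
      have := weight_le_five la ld had.symm hbi
      rw [weight_of_mem ha]; omega)
    (by
      have := weight_le_five ld la had hbi
      rw [weight_of_mem hd]; omega)
  refine h.calm.payable_of_gain (g := 20) (by norm_num) le_rfl p hgain ?_
  intro r e he hpl hweak
  have heW := (hm e).1 he
  have hW2 : (play G W p).erase e ⊆ W := (Finset.erase_subset _ _).trans play_subset
  right
  rcases hweak with ⟨hei, hex⟩ | ⟨⟨t, ht, het⟩, -⟩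
  · have heb : e ≠ b := by
      rintro rfl
      obtain ⟨t, ht, hte, hat⟩ := hex a hba
      exact hte (la.2.2.2 t ht hat)
    have heiW : ∀ t ∈ W, ¬ G.Adj e t := by
      intro t ht het
      by_cases htm : t ∈ play G W p
      · exact hei t htm het
      · rw [hm] at htm
        have : t = p ∨ t = a ∨ t = d := by tauto
        rcases this with rfl | rfl | rfl
        · have := np e heW.1 het.symm
          tauto
        · have := na e heW.1 het.symm
          tauto
        · have := nd e heW.1 het.symm
          tauto
    obtain ⟨x, hexx⟩ := hG e
    obtain ⟨t, ht, hte, hxt⟩ := hex x hexx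
    have htW := (hm t).1 ht
    have hx : x ∉ W := fun h' => heiW x h' hexx
    have hleaf : IsLeafAt G ((play G W p).erase e) x t := by
      refine ⟨fun h' => hx (hW2 h'), Finset.mem_erase.2 ⟨hte, ht⟩, hxt, fun q hq hxq => ?_⟩
      exact (h.eq_of_adj_isolated hx heW.1 htW.1 (hW2 hq) hexx.symm hxt hxq hte heiW).resolve_left
        (Finset.ne_of_mem_erase hq)
    -- If `t = b`, it has three leaves `a`, `d`, `x`, and playing it gains 10 + 3 · 5.
    by_cases htb : t = b
    · subst htb
      have hsub := Finset.erase_subset e (play G W p)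
      have hle : ∀ y, IsLeafAt G ((play G W p).erase e) y t →
          weight G (play G ((play G W p).erase e) t) y + 5 ≤
            weight G ((play G W p).erase e) y := fun y hy =>
        drop_five (fun h' => hy.1 (play_subset h')) (fun q hq hyq => (mem_play.1 hq).2.1
          (hy.2.2.2 q (play_subset hq) hyq)) hy.2.1 hy.2.2.1
      have := gain_four (W' := play G ((play G W p).erase e) t) (a := t) (b := a) (c := d) (d := x)
        play_subset (by simp; grind [hba.ne, hbd.ne]) (drop_played hleaf.2.1)
        (hle a (la.of_subset hsub hleaf.2.1)) (hle d (ld.of_subset hsub hleaf.2.1)) (hle x hleaf)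
      exact ⟨t, by omega⟩
    · obtain ⟨s, hs, hts⟩ : ∃ s ∈ W, G.Adj t s := by
        by_contra! hti
        exact hte (h.eq_of_isolated hx htW.1 heW.1 hxt hexx.symm hti heiW)
      refine (h.calm.mono hW2).exists_gain_of_leaf hleaf (t := s) ?_ hts
      rw [Finset.mem_erase, hm]
      refine ⟨?_, hs, ?_, ?_, ?_⟩
      · rintro rfl
        exact heiW t htW.1 hts.symm
      · rintro rfl
        have := np t htW.1 hts.symm
        tauto
      · rintro rfl
        have := na t htW.1 hts.symm
        tauto
      · rintro rfl
        have := nd t htW.1 hts.symm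
        tauto
  · have htW := (hm t).1 ht
    have heb : e ≠ b := by
      rintro rfl
      exact hbi t ht het
    obtain ⟨s, hs, hes, hst⟩ := h.exists_ne hno heW.1 htW.1 het
    refine h.exists_gain_of_erase (fun t => t = p ∨ t = a ∨ t = d ∨ t = b) heW.1 htW.1 hs het hes
      hst.symm ?_ (by tauto) hW2 (by simp) ?_
    · rintro s t (rfl | rfl | rfl | rfl) ht hst
      · have := np t ht hst; tauto
      · have := na t ht hst; tauto
      · have := nd t ht hst; tauto
      · have := nb t ht hst; tauto
    · intro t ht hte hR
      rw [Finset.mem_erase, hm]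
      tauto

/-- Playing `p` leaves a path whose ends `b`, `c` carry the leaves `a`, `d`. One newly dominated
vertex spoils only one end, except for the middle vertex when the cycle has length six; that vertex
then dominates the isolated `b` and `c` together. All answers gain 26. -/
theorem Critical.payable_of_path (h : Critical G W)
    (hno : ∀ u w, ¬ IsPair G W u w) (hp : p ∈ W) (ha : a ∈ W) (hd : d ∈ W) (hb : b ∈ W)
    (hc : c ∈ W) (hpa : G.Adj p a) (hpd : G.Adj p d) (hab : G.Adj a b) (hdc : G.Adj d c)
    (had : a ≠ d) (hpb : p ≠ b) (hpc : p ≠ c) (hbc : b ≠ c) (hnbc : ¬ G.Adj b c) :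
    Payable G W := by
  have hm : ∀ t, t ∈ play G W p ↔ t ∈ W ∧ t ≠ p ∧ t ≠ a ∧ t ≠ d :=
    fun t => h.mem_play_iff hp ha hd hpa hpd had
  have nad := h.not_triangle hp ha hd hpa hpd
  have np : ∀ t ∈ W, G.Adj p t → t = a ∨ t = d := fun t ht hat =>
    h.eq_of_adj hp ha hd ht hpa hpd hat had
  have hside : ∀ a b c d, a ∈ W → b ∈ W → d ∈ W → c ∈ W → G.Adj p a → G.Adj p d → G.Adj a b →
      G.Adj d c → a ≠ d → p ≠ b → p ≠ c → b ≠ c → ¬ G.Adj a d →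
      (∀ t, t ∈ play G W p ↔ t ∈ W ∧ t ≠ p ∧ t ≠ a ∧ t ≠ d) → ∃ e, e ∈ play G W p ∧ G.Adj b e ∧
        IsLeafAt G (play G W p) a b ∧ (∀ t ∈ play G W p, G.Adj b t → t = e) := by
    intro a b c d ha hb hd hc hpa hpd hab hdc had hpb hpc hbc nad hm
    obtain ⟨e, he, hbe, hea⟩ := h.exists_ne hno hb ha hab.symm
    have na : ∀ t ∈ W, G.Adj a t → t = p ∨ t = b := fun t ht hat =>
      h.eq_of_adj ha hp hb ht hpa.symm hab hat hpb
    have nd : ∀ t ∈ W, G.Adj d t → t = p ∨ t = c := fun t ht hat =>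
      h.eq_of_adj hd hp hc ht hpd.symm hdc hat hpc
    have hbd : b ≠ d := fun h' => nad (h' ▸ hab)
    refine ⟨e, (hm e).2 ⟨he, ?_, hea, ?_⟩, hbe, ⟨by simp [hm],
      (hm b).2 ⟨hb, hpb.symm, hab.ne', hbd⟩, hab, fun t ht hat => ?_⟩, fun t ht hbt => ?_⟩
    · rintro rfl
      have := h.eq_of_adj hp ha hd hb hpa hpd hbe.symm had
      grind [hab.ne]
    · rintro rfl
      have := nd b hb hbe.symm
      grind
    · rw [hm] at ht
      have := na t ht.1 hat
      tauto
    · rw [hm] at ht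
      have := h.eq_of_adj hb ha he ht.1 hab.symm hbe hbt hea.symm
      tauto
  obtain ⟨e, he, hbe, la, nb⟩ :=
    hside a b c d ha hb hd hc hpa hpd hab hdc had hpb hpc hbc nad hm
  obtain ⟨f, hf, hcf, ld, nc⟩ :=
    hside d c b a hd hc ha hb hpd hpa hdc hab had.symm hpc hpb hbc.symm (fun h => nad h.symm)
      (fun t => by rw [hm]; tauto)
  have hgain := gain_three (W' := play G W p) (a := p) (b := a) (c := d)
    play_subset (by simp; grind [hpa.ne, hpd.ne]) (drop_played hp)
    (h.calm.drop_four play_subset ha (by simp [hm]))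
    (h.calm.drop_four play_subset hd (by simp [hm]))
  refine h.calm.payable_of_gain (g := 18) le_rfl (by norm_num) p hgain ?_
  intro r z hz hpl hweak
  right
  have hend : ∀ a b e, e ∈ play G W p → G.Adj b e → IsLeafAt G (play G W p) a b →
      (∀ t ∈ play G W p, G.Adj b t → t = e) → z ≠ b → z ≠ e →
      ∃ v', potential G (play G ((play G W p).erase z) v') + (44 - 18) ≤
        potential G ((play G W p).erase z) := by
    intro a b e he hbe la nb hzb hze
    have hb' := Finset.mem_erase.2 ⟨hzb.symm, la.2.1⟩
    exact ⟨e, gain_of_end_leaf (Finset.mem_erase.2 ⟨hze.symm, he⟩) hb' hbe.symm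
      (fun t ht => nb t (Finset.mem_of_mem_erase ht))
      (la.of_subset (Finset.erase_subset _ _) hb')⟩
  by_cases h1 : z ≠ b ∧ z ≠ e
  · exact hend a b e he hbe la nb h1.1 h1.2
  by_cases h2 : z ≠ c ∧ z ≠ f
  · exact hend d c f hf hcf ld nc h2.1 h2.2
  have h3 : z = e ∧ z = f := by grind [G.adj_comm]
  obtain ⟨rfl, rfl⟩ := h3
  refine ⟨z, gain_of_two_isolated (by simp) (Finset.mem_erase.2 ⟨hbe.ne, la.2.1⟩)
    (Finset.mem_erase.2 ⟨hcf.ne, ld.2.1⟩) hbc hbe.symm hcf.symm (fun t ht hbt => ?_)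
    (fun t ht hbt => ?_)⟩
  · exact Finset.ne_of_mem_erase ht (nb t (Finset.mem_of_mem_erase ht) hbt)
  · exact Finset.ne_of_mem_erase ht (nc t (Finset.mem_of_mem_erase ht) hbt)

end Cycle

/-! ### Pentagons. -/

section Pentagon

variable {V : Type*} [Fintype V] {G : SimpleGraph V} {W : Finset V}
  {p a b c d e f u v w x y z s t : V}

theorem IsPentagon.mem_play_iff {V : Type*} {G : SimpleGraph V} {W : Finset V} {p a b c d t : V}
    (P : IsPentagon G W p a b c d) :
    t ∈ play G W p ↔ t ∈ W ∧ t ≠ p ∧ t ≠ a ∧ t ≠ d := by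
  rw [mem_play]
  constructor
  · rintro ⟨h1, h2, h3⟩
    refine ⟨h1, h2, ?_, ?_⟩ <;> rintro rfl
    · exact h3 P.adj₁
    · exact h3 P.adj₅.symm
  · rintro ⟨h1, h2, h3, h4⟩
    exact ⟨h1, h2, fun h5 => (P.eq₁ t h1 h5).elim h3 h4⟩

theorem IsPentagon.gain (hc : Calm G W) (P : IsPentagon G W p a b c d) :
    potential G (play G W p) + 18 ≤ potential G W :=
  gain_three (a := p) (b := a) (c := d) play_subset (by have := P.nodup; simp at this ⊢; tauto)
    (drop_played P.mem₁) (hc.drop_four play_subset P.mem₂ (by simp [mem_play, P.adj₁]))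
    (hc.drop_four play_subset P.mem₅ (by simp [mem_play, P.adj₅.symm]))

theorem IsPentagon.mem_play₃ {V : Type*} {G : SimpleGraph V} {W : Finset V} {p a b c d : V}
    (P : IsPentagon G W p a b c d) : b ∈ play G W p := by
  have := P.nodup
  rw [P.mem_play_iff]
  simp at this
  exact ⟨P.mem₃, by tauto, by tauto, by tauto⟩

theorem IsPentagon.play_eq {V : Type*} {G : SimpleGraph V} {W : Finset V} {p a b c d : V}
    (P : IsPentagon G W p a b c d) :
    ∀ t ∈ play G W p, G.Adj b t → t = c := fun t ht hbt => by
  rw [P.mem_play_iff] at ht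
  exact (P.eq₃ t ht.1 hbt).resolve_left ht.2.2.1

theorem IsPentagon.isLeafAt {V : Type*} {G : SimpleGraph V} {W : Finset V} {p a b c d : V}
    (P : IsPentagon G W p a b c d) : IsLeafAt G (play G W p) a b :=
  ⟨fun h => (P.mem_play_iff.1 h).2.2.1 rfl, P.mem_play₃, P.adj₂, fun t ht hat =>
    (P.eq₂ t (play_subset ht) hat).resolve_left (P.mem_play_iff.1 ht).2.1⟩

/-- Playing `p` leaves the edge from `b` to `c` with the leaf `a` at `b`; playing `c` clears all
three if the reply spares the edge. -/
theorem IsPentagon.gain_of_reply (P : IsPentagon G W p a b c d) (hb : e ≠ b) (hc : e ≠ c) :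
    potential G (play G ((play G W p).erase e) c) + 26 ≤
      potential G ((play G W p).erase e) := by
  have hb' := Finset.mem_erase.2 ⟨hb.symm, P.mem_play₃⟩
  exact gain_of_end_leaf (Finset.mem_erase.2 ⟨hc.symm, P.symm.mem_play₃⟩) hb' P.adj₃.symm
    (fun t ht => P.play_eq t (Finset.mem_of_mem_erase ht))
    (P.isLeafAt.of_subset (Finset.erase_subset _ _) hb')

theorem IsPentagon.erase_isolated {V : Type*} {G : SimpleGraph V} {W : Finset V} {p a b c d : V}
    (P : IsPentagon G W p a b c d) :
    ∀ t ∈ (play G W p).erase b, ¬ G.Adj c t := fun _ ht hct =>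
  Finset.ne_of_mem_erase ht (P.symm.play_eq _ (Finset.mem_of_mem_erase ht) hct)

theorem IsPentagon.payable_of_gain (hc : Calm G W) (P : IsPentagon G W p a b c d)
    (h : ∀ b' c' r, (b' = b ∧ c' = c ∨ b' = c ∧ c' = b) → IsWeakReply G (play G W p) r b' →
      potential G ((play G W p).erase b') + 10 ≤ potential G (play G W p) →
      potential G ((play G W p).erase b') + 32 ≤ potential G W ∨
      ∃ v', Legal G ((play G W p).erase b') v' ∧
        potential G (play G ((play G W p).erase b') v') + 48 ≤ potential G W ∧
        ∀ r', Legal G (play G ((play G W p).erase b') v') r' →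
          potential G (play G (play G ((play G W p).erase b') v') r') + 64 ≤ potential G W) :
    Payable G W := by
  have hc2 : ∀ e, Calm G ((play G W p).erase e) := fun e =>
    hc.mono ((Finset.erase_subset _ _).trans play_subset)
  refine hc.payable_of_gain_of_replies p (P.gain hc) fun r z hz hpl hw => ?_
  have h10 := (hc.mono play_subset).gain_ten_of_legal (v := r) (W := play G W p) (by
    by_contra hr
    have : z ∈ play G (play G W p) r := mem_play.2 ⟨hz, by
      simp only [Legal, not_exists, not_and, not_or] at hr
      exact hr z hz⟩
    rw [hpl] at this
    exact Finset.notMem_erase _ _ this)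
  rw [hpl] at h10
  by_cases hzb : z = b
  · subst hzb
    exact h z c r (by tauto) hw h10
  by_cases hzc : z = c
  · subst hzc
    exact h z b r (by tauto) hw h10
  right
  have := P.gain hc
  exact ⟨c, (hc2 z).legal_and_of_gain (by norm_num) (P.gain_of_reply hzb hzc) (by omega)⟩

/-- A dominated vertex joining two vertices of a pentagon at distance two. -/
theorem IsPentagon.payable_of_chord (hc : Calm G W) (P : IsPentagon G W p a b c d) (hy : y ∉ W)
    (hyb : G.Adj y b) (hyp : G.Adj y p) (hyt : ∀ t ∈ W, G.Adj y t → t = b ∨ t = p) :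
    Payable G W := by
  have hn := P.nodup
  simp at hn
  have hly : IsLeafAt G (play G W p) y b :=
    ⟨fun h => hy (play_subset h), P.mem_play₃, hyb, fun t ht hyt' =>
      (hyt t (play_subset ht) hyt').resolve_right (P.mem_play_iff.1 ht).2.1⟩
  refine P.payable_of_gain hc fun b' c' r hbc hw h10 => Or.inr ?_
  rcases hbc with ⟨rfl, rfl⟩ | ⟨rfl, rfl⟩
  -- A weak reply at `b` would need a sole leaf there, but both `a` and `y` are leaves.
  · exfalso
    rcases hw with ⟨hi, -⟩ | ⟨-, -, hu⟩
    · exact hi _ P.symm.mem_play₃ P.adj₃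
    · have := (hu a P.isLeafAt).trans (hu y hly).symm
      exact hy (this ▸ P.mem₂)
  -- Three moves clear the whole pentagon and `y`, gaining 50 + 6.
  · set W' := play G ((play G W p).erase b') c' with hW'
    have hW : W' ⊆ W := play_subset.trans ((Finset.erase_subset _ _).trans play_subset)
    have hm : ∀ t ∈ W', t ≠ p ∧ t ≠ a ∧ t ≠ c' ∧ t ≠ b' ∧ t ≠ d := by
      intro t ht
      rw [hW', mem_play, Finset.mem_erase, P.mem_play_iff] at ht
      tauto
    have h56 := gain_six (W' := W') (a := p) (b := a) (c := c') (d := b') (e := d) (f := y) hW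
      (by have := P.mem₁; have := P.mem₂; have := P.mem₃; have := P.mem₄; have := P.mem₅
          simp; grind)
      (drop_ten P.mem₁ (fun h => (hm _ h).1 rfl) fun t ht h => by
        have := P.eq₁ t (hW ht) h; have := hm t ht; tauto)
      (drop_ten P.mem₂ (fun h => (hm _ h).2.1 rfl) fun t ht h => by
        have := P.eq₂ t (hW ht) h; have := hm t ht; tauto)
      (drop_ten P.mem₃ (fun h => (hm _ h).2.2.1 rfl) fun t ht h => by
        have := P.eq₃ t (hW ht) h; have := hm t ht; tauto)
      (drop_ten P.mem₄ (fun h => (hm _ h).2.2.2.1 rfl) fun t ht h => by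
        have := P.eq₄ t (hW ht) h; have := hm t ht; tauto)
      (drop_ten P.mem₅ (fun h => (hm _ h).2.2.2.2 rfl) fun t ht h => by
        have := P.eq₅ t (hW ht) h; have := hm t ht; tauto)
      (drop_six_of_ne (fun h => hy (hW h)) (fun t ht h => by
        have := hyt t (hW ht) h; have := hm t ht; tauto) P.mem₃ P.mem₁ (by tauto) hyb hyp)
    refine ⟨c', ⟨c', Finset.mem_erase.2 ⟨P.adj₃.ne, P.mem_play₃⟩, Or.inl rfl⟩, ?_,
      fun r' hr' => ?_⟩ <;> rw [← hW'] at *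
    · omega
    have := (hc.mono hW).gain_ten_of_legal hr'
    omega

/-- Two dominated vertices joining an isolated vertex to two vertices of a pentagon at distance
two. -/
theorem IsPentagon.payable_of_bridge (hc : Calm G W) (P : IsPentagon G W p a b c d) (hx : x ∉ W)
    (hy : y ∉ W) (hv : v ∈ W) (hvi : ∀ t ∈ W, ¬ G.Adj v t) (hxv : G.Adj x v) (hxp : G.Adj x p)
    (hxt : ∀ t ∈ W, G.Adj x t → t = v ∨ t = p) (hyv : G.Adj y v) (hyb : G.Adj y b)
    (hyt : ∀ t ∈ W, G.Adj y t → t = v ∨ t = b) : Payable G W := by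
  have hn := P.nodup
  simp at hn
  have hc2 : ∀ e, Calm G ((play G W p).erase e) := fun e =>
    hc.mono ((Finset.erase_subset _ _).trans play_subset)
  have hxy : x ≠ y := by
    rintro rfl
    have := hxt b P.mem₃ hyb
    have : v ≠ b := by rintro rfl; exact hvi _ P.mem₄ P.adj₃
    tauto
  have hxW : ∀ q ∈ W, q ≠ x := fun q hq h => hx (h ▸ hq)
  have hyW : ∀ q ∈ W, q ≠ y := fun q hq h => hy (h ▸ hq)
  have hnd : [p, a, d, b, x, y].Nodup := by
    have h1 := hxW p P.mem₁
    have h2 := hxW a P.mem₂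
    have h3 := hxW b P.mem₃
    have h4 := hxW d P.mem₅
    have h5 := hyW p P.mem₁
    have h6 := hyW a P.mem₂
    have h7 := hyW b P.mem₃
    have h8 := hyW d P.mem₅
    simp only [List.nodup_cons, List.mem_cons, List.not_mem_nil, or_false, not_or,
      List.nodup_nil, and_true, not_false_eq_true]
    refine ⟨⟨?_, ?_, ?_, h1, h5⟩, ⟨?_, ?_, h2, h6⟩, ⟨?_, h4, h8⟩, ⟨h3, h7⟩, hxy⟩ <;> grind
  have hbd : b ≠ d := by grind
  have hcb : c ≠ b := by grind
  have hcm₁ : c ≠ p ∧ c ≠ a ∧ c ≠ d := by grind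
  clear hn
  have hvp : v ≠ p := by rintro rfl; exact hvi _ P.mem₂ P.adj₁
  have hva : v ≠ a := by rintro rfl; exact hvi _ P.mem₃ P.adj₂
  have hvb : v ≠ b := by rintro rfl; exact hvi _ P.mem₄ P.adj₃
  have hvc : v ≠ c := by rintro rfl; exact hvi _ P.mem₅ P.adj₄
  have hvd : v ≠ d := by rintro rfl; exact hvi _ P.mem₁ P.adj₅
  have hvm : v ∈ play G W p := P.mem_play_iff.2 ⟨hv, hvp, hva, hvd⟩
  have hgain := P.gain hc
  refine P.payable_of_gain hc fun b' c' r hbc hw h10 => ?_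
  rcases hbc with ⟨rfl, rfl⟩ | ⟨rfl, rfl⟩
  -- Twins arise at `v` (`x`, `y`) and at `c'` (`d`, `b'`): 10 + 10 + 5 + 5 + 1 + 1 = 32.
  · left
    set W' := (play G W p).erase b' with hW'
    have hW : W' ⊆ W := (Finset.erase_subset _ _).trans play_subset
    have hm : ∀ t, t ∈ W' ↔ t ∈ W ∧ t ≠ p ∧ t ≠ a ∧ t ≠ d ∧ t ≠ b' := by
      intro t
      rw [hW', Finset.mem_erase, P.mem_play_iff]
      tauto
    have hcm : c' ∈ W' := (hm c').2 ⟨P.mem₄, hcm₁.1, hcm₁.2.1, hcm₁.2.2, hcb⟩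
    have hvm' : v ∈ W' := (hm v).2 ⟨hv, hvp, hva, hvd, hvb⟩
    have lx : IsLeafAt G W' x v := ⟨fun h => hx (hW h), hvm', hxv, fun t ht h => by
      have := hxt t (hW ht) h; have := (hm t).1 ht; tauto⟩
    have ly : IsLeafAt G W' y v := ⟨fun h => hy (hW h), hvm', hyv, fun t ht h => by
      have := hyt t (hW ht) h; have := (hm t).1 ht; tauto⟩
    have ld : IsLeafAt G W' d c' := ⟨by simp [hm], hcm, P.adj₄.symm, fun t ht h => by
      have := P.eq₅ t (hW ht) h; have := (hm t).1 ht; tauto⟩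
    have lb : IsLeafAt G W' b' c' := ⟨by simp [hm], hcm, P.adj₃, fun t ht h => by
      have := P.eq₃ t (hW ht) h; have := (hm t).1 ht; tauto⟩
    have hvi' : ∀ t ∈ W', ¬ G.Adj v t := fun t ht => hvi t (hW ht)
    have wx := weight_le_five lx ly hxy.symm hvi'
    have wy := weight_le_five ly lx hxy hvi'
    have wd := weight_le_five ld lb hbd P.erase_isolated
    have wb := weight_le_five lb ld hbd.symm P.erase_isolated
    have wx' := six_le_weight_of_ne hv P.mem₁ hvp hxv hxp
    have wy' := six_le_weight_of_ne hv P.mem₃ hvb hyv hyb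
    have wd' := weight_of_mem (G := G) P.mem₅
    have wb' := weight_of_mem (G := G) P.mem₃
    have := gain_six (W' := W') (a := p) (b := a) (c := d) (d := b') (e := x) (f := y)
      (k := 5) (l := 5) (m := 1) (n := 1) hW hnd
      (drop_ten P.mem₁ (by simp [hm]) fun t ht h => by
        have := P.eq₁ t (hW ht) h; have := (hm t).1 ht; tauto)
      (drop_ten P.mem₂ (by simp [hm]) fun t ht h => by
        have := P.eq₂ t (hW ht) h; have := (hm t).1 ht; tauto)
      (by omega) (by omega) (by omega) (by omega)
    omega
  · right
    have hbm : c' ∈ (play G W p).erase b' := Finset.mem_erase.2 ⟨P.adj₃.ne, P.mem_play₃⟩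
    have hsub : (play G W p).erase b' ⊆ W := (Finset.erase_subset _ _).trans play_subset
    have h26 := gain_of_two_isolated (G := G) (W := (play G W p).erase b') (y := y) (a := v)
      (b := c') (fun h => hy (hsub h)) (Finset.mem_erase.2 ⟨hvc, hvm⟩) hbm hvb hyv hyb
      (fun t ht => hvi t (hsub ht)) P.symm.erase_isolated
    exact ⟨y, (hc2 b').legal_and_of_gain (by norm_num) h26 (by omega)⟩

end Pentagon

/-! ### Remaining cases and their assembly. -/

section Payable

variable {V : Type*} [Fintype V] {G : SimpleGraph V} {W W' : Finset V}
  {p a b c d e f u v w x y z s t : V}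

theorem six_le_weight_of_unique (hx : IsLeafAt G W x z) (h : ∀ y, IsLeafAt G W y z → y = x) :
    6 ≤ weight G W x := by
  have h1 : ¬ ∀ z ∈ W, ¬ G.Adj x z := fun h' => h' z hx.2.1 hx.2.2.1
  have h2 : ¬ IsTwin G W x := by
    rintro ⟨a, b, hab, hxa, hb, -⟩
    obtain rfl := hxa.2.2.2 z hx.2.1 hx.2.2.1
    exact hab (h b hb)
  rw [weight, if_neg hx.1]; split_ifs <;> simp

/-- A sole leaf is no twin and releases 6; with more leaves, two already release 5 each. -/
theorem gain_of_isolated_leaf (hW : W' ⊆ W) (hv : v ∈ W) (hv' : v ∉ W')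
    (hvi : ∀ t ∈ W, ¬ G.Adj v t) (hx : IsLeafAt G W x v) :
    potential G W' + 16 ≤ potential G W := by
  have hred : ∀ y, IsLeafAt G W y v → y ∉ W' ∧ ∀ t ∈ W', ¬ G.Adj y t := fun y hy =>
    ⟨fun h => hy.1 (hW h), fun t ht hyt => hv' (hy.2.2.2 t (hW ht) hyt ▸ ht)⟩
  have hv10 := drop_ten hv hv' fun t ht => hvi t (hW ht)
  by_cases h : ∃ y, IsLeafAt G W y v ∧ y ≠ x
  · obtain ⟨y, hy, hyx⟩ := h
    have := gain_three hW (by simp; grind [hx.2.2.1.ne, hy.2.2.1.ne]) hv10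
      (drop_five (hred x hx).1 (hred x hx).2 hv hx.2.2.1)
      (drop_five (hred y hy).1 (hred y hy).2 hv hy.2.2.1)
    omega
  · push Not at h
    have h6 := six_le_weight_of_unique hx h
    exact gain_two (b := x) (j := 6) hW (by simp [hx.2.2.1.ne']) hv10 (by
      rw [weight_eq_zero (hred x hx).1 (hred x hx).2]; omega)

theorem payable_of_isolated (hG : ∀ x, ∃ y, G.Adj x y) (hW : W.Nonempty)
    (hi : ∀ v ∈ W, ∀ t ∈ W, ¬ G.Adj v t)
    (hl : ∀ x, x ∉ W → ∀ v ∈ W, ∀ t ∈ W, G.Adj x v → G.Adj x t → t = v) : Payable G W := by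
  have key : ∀ W' ⊆ W, ∀ v, Legal G W' v → potential G (play G W' v) + 16 ≤ potential G W' := by
    rintro W' hW' v ⟨z, hz, hvz⟩
    obtain ⟨x, hzx⟩ := hG z
    have hx : x ∉ W := fun h => hi z (hW' hz) x h hzx
    refine gain_of_isolated_leaf play_subset hz (by rw [mem_play]; tauto)
      (fun t ht => hi z (hW' hz) t (hW' ht))
      ⟨fun h => hx (hW' h), hz, hzx.symm, fun t ht h => hl x hx z (hW' hz) t (hW' ht) hzx.symm h⟩
  obtain ⟨v, hv⟩ := hW
  have hlv : Legal G W v := ⟨v, hv, Or.inl rfl⟩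
  refine ⟨v, hlv, key W subset_rfl v hlv, fun r hr => Or.inl ?_⟩
  have := key W subset_rfl v hlv
  have := key _ play_subset r hr
  omega

/-- A dominated vertex joins an isolated vertex to a pentagon. -/
theorem IsPentagon.payable_of_joined (h : Critical G W) (P : IsPentagon G W p a b c d)
    (hx : x ∉ W) (hv : v ∈ W) (hvi : ∀ t ∈ W, ¬ G.Adj v t) (hxv : G.Adj x v)
    (hxp : G.Adj x p) : Payable G W := by
  by_contra hcon
  have hvp : p ≠ v := by rintro rfl; exact hvi _ P.mem₂ P.adj₁
  have hxt : ∀ t ∈ W, G.Adj x t → t = v ∨ t = p := fun t ht hxt =>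
    h.eq_of_adj_isolated hx hv P.mem₁ ht hxv hxp hxt hvp hvi
  have hm : ∀ t, t ∈ play G W x ↔ t ∈ W ∧ t ≠ v ∧ t ≠ p := by
    intro t
    rw [mem_play]
    constructor
    · rintro ⟨h1, h2, h3⟩
      refine ⟨h1, ?_, ?_⟩ <;> rintro rfl <;> contradiction
    · rintro ⟨h1, h2, h3⟩
      refine ⟨h1, ?_, fun h4 => ?_⟩
      · rintro rfl
        exact hx h1
      · have := hxt t h1 h4
        tauto
  have hgain := gain_three (W' := play G W x) (a := x) (b := v) (c := p) play_subset
    (by simp; grind [hxv.ne, hxp.ne])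
    (drop_six_of_ne (fun h => hx (play_subset h)) (fun z hz => (mem_play.1 hz).2.2) hv P.mem₁
      hvp.symm hxv hxp)
    (drop_ten hv (by simp [hm]) fun t ht => hvi t (play_subset ht))
    (h.calm.drop_four play_subset P.mem₁ (by simp [hm]))
  refine hcon (h.calm.payable_of_gain (g := 20) (by norm_num) le_rfl x hgain ?_)
  intro r e he hpl hweak
  right
  have hc2 : Calm G ((play G W x).erase e) :=
    h.calm.mono ((Finset.erase_subset _ _).trans play_subset)
  have hm2 : ∀ t, t ∈ (play G W x).erase e ↔ t ≠ e ∧ t ∈ W ∧ t ≠ v ∧ t ≠ p := by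
    intro t; rw [Finset.mem_erase, hm]
  -- the statement is symmetric under the reflection of the pentagon that fixes `p`
  have side : ∀ a b c d, IsPentagon G W p a b c d → (e = a ∨ e = b) →
      ∃ v', potential G (play G ((play G W x).erase e) v') + (44 - 20) ≤
        potential G ((play G W x).erase e) := by
    intro a b c d P heab
    have hn := P.nodup
    simp at hn
    have hvn : ∀ t s, s ∈ W → G.Adj t s → t ≠ v := by
      rintro t s hs hts rfl
      exact hvi s hs hts
    rcases heab with rfl | rfl
    · refine ⟨c, hc2.gain_of_end (v := c) (a := b) (b := d) ((hm2 c).2 ⟨?_, P.mem₄, ?_, ?_⟩)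
        ((hm2 b).2 ⟨?_, P.mem₃, ?_, ?_⟩) ((hm2 d).2 ⟨?_, P.mem₅, ?_, ?_⟩) P.adj₃.symm P.adj₄ ?_
        fun t ht hbt => ?_⟩
      · grind
      · exact hvn _ _ P.mem₅ P.adj₄
      · grind
      · grind
      · exact hvn _ _ P.mem₄ P.adj₃
      · grind
      · grind
      · exact hvn _ _ P.mem₁ P.adj₅
      · grind
      · grind
      · rw [hm2] at ht
        exact (P.eq₃ t ht.2.1 hbt).resolve_left ht.1
    -- The sole leaf `r` used by a weak reply at `e = b` sees `v` (a bridge), or `p` (a chord), or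
    -- was a leaf already in the critical position.
    · exfalso
      have ham : a ∈ play G W x := (hm a).2 ⟨P.mem₂, hvn _ _ P.mem₃ P.adj₂, by grind⟩
      rcases hweak with ⟨hi, -⟩ | ⟨-, hr, -⟩
      · exact hi a ham P.adj₂.symm
      have hrW : r ∉ W := by
        intro hrW
        have : r = v ∨ r = p := by
          have := hr.1
          rw [hm] at this
          tauto
        rcases this with rfl | rfl
        · exact hvi e P.mem₃ hr.2.2.1
        · have := P.eq₁ e P.mem₃ hr.2.2.1
          grind
      have hrt : ∀ t ∈ W, G.Adj r t → t = e ∨ t = v ∨ t = p := by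
        intro t ht hrt
        by_contra! hne
        exact hne.1 (hr.2.2.2 t ((hm t).2 ⟨ht, hne.2⟩) hrt)
      by_cases hrv : G.Adj r v
      · refine hcon (P.payable_of_bridge h.calm hx hrW hv hvi hxv hxp hxt hrv hr.2.2.1 ?_)
        exact fun t ht hrt => h.eq_of_adj_isolated hrW hv P.mem₃ ht hrv hr.2.2.1 hrt
          (hvn _ _ P.mem₂ P.adj₂.symm) hvi
      by_cases hrp : G.Adj r p
      · refine hcon (P.payable_of_chord h.calm hrW hr.2.2.1 hrp fun t ht h' => ?_)
        rcases hrt t ht h' with h1 | rfl | h1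
        · exact Or.inl h1
        · exact absurd h' hrv
        · exact Or.inr h1
      · refine h.not_adj_of_leaf ⟨hrW, P.mem₃, hr.2.2.1, fun t ht h' => ?_⟩ P.mem₂ P.adj₂.symm
        rcases hrt t ht h' with h1 | rfl | rfl
        · exact h1
        · exact absurd h' hrv
        · exact absurd h' hrp
  by_cases h1 : e = a ∨ e = b
  · exact side a b c d P h1
  by_cases h2 : e = d ∨ e = c
  · exact side d c b a P.symm h2
  have hn := P.nodup
  simp at hn
  refine ⟨b, hc2.gain_of_end (v := b) (a := a) (b := c) ((hm2 b).2 ⟨?_, P.mem₃, ?_, ?_⟩)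
    ((hm2 a).2 ⟨?_, P.mem₂, ?_, ?_⟩) ((hm2 c).2 ⟨?_, P.mem₄, ?_, ?_⟩) P.adj₂.symm P.adj₃ ?_
    fun t ht hbt => ?_⟩
  · grind
  · rintro rfl; exact hvi _ P.mem₄ P.adj₃
  · grind
  · grind
  · rintro rfl; exact hvi _ P.mem₃ P.adj₂
  · grind
  · grind
  · rintro rfl; exact hvi _ P.mem₅ P.adj₄
  · grind
  · grind
  · rw [hm2] at ht
    exact (P.eq₂ t ht.2.1 hbt).resolve_left ht.2.2.2

/-- No dominated vertex joins an isolated vertex to another vertex. -/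
theorem IsPentagon.payable_of_not_joined (h : Critical G W) (hG : ∀ x, ∃ y, G.Adj x y)
    (P : IsPentagon G W p a b c d)
    (hl : ∀ x, x ∉ W → ∀ v ∈ W, (∀ t ∈ W, ¬ G.Adj v t) → G.Adj x v → ∀ t ∈ W, G.Adj x t → t = v) :
    Payable G W := by
  refine P.payable_of_gain h.calm fun b' c' r hbc hw h10 => Or.inr ?_
  have key : ∀ a b c d, IsPentagon G W p a b c d →
      ∃ v', Legal G ((play G W p).erase b) v' ∧
        potential G (play G ((play G W p).erase b) v') + 48 ≤ potential G W ∧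
        ∀ r', Legal G (play G ((play G W p).erase b) v') r' →
          potential G (play G (play G ((play G W p).erase b) v') r') + 64 ≤ potential G W := by
    clear! a b c d b' c' r
    intro a b c d P
    have hn := P.nodup
    have hbd : b ≠ d := by simp at hn; grind
    have hcm₁ : c ≠ p ∧ c ≠ a := by simp at hn; grind
    set W' := (play G W p).erase b with hW'
    have hW : W' ⊆ W := (Finset.erase_subset _ _).trans play_subset
    have hc' := h.calm.mono hW
    have hm : ∀ t, t ∈ W' ↔ t ∈ W ∧ t ≠ p ∧ t ≠ a ∧ t ≠ d ∧ t ≠ b := by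
      intro t
      rw [hW', Finset.mem_erase, P.mem_play_iff]
      tauto
    have hcm : c ∈ W' := (hm c).2 ⟨P.mem₄, hcm₁.1, hcm₁.2, P.adj₄.ne, P.adj₃.ne'⟩
    have hci : ∀ t ∈ W', ¬ G.Adj c t := P.erase_isolated
    have ld : IsLeafAt G W' d c := ⟨by simp [hm], hcm, P.adj₄.symm, fun t ht h => by
      have := P.eq₅ t (hW ht) h; have := (hm t).1 ht; tauto⟩
    have lb : IsLeafAt G W' b c := ⟨by simp [hm], hcm, P.adj₃, fun t ht h => by
      have := P.eq₃ t (hW ht) h; have := (hm t).1 ht; tauto⟩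
    -- The vertices `b` and `d` become twins at the isolated `c`; after 30 in two moves, 24
    -- suffices.
    have h30 : potential G W' + 30 ≤ potential G W := by
      have wd := weight_le_five ld lb hbd hci
      have wb := weight_le_five lb ld hbd.symm hci
      have wd' := weight_of_mem (G := G) P.mem₅
      have wb' := weight_of_mem (G := G) P.mem₃
      exact gain_four (a := p) (b := a) (c := d) (d := b) (k := 5) (l := 5) hW
        (by simp at hn ⊢; grind)
        (drop_ten P.mem₁ (by simp [hm]) fun t ht h => by
          have := P.eq₁ t (hW ht) h; have := (hm t).1 ht; tauto)
        (drop_ten P.mem₂ (by simp [hm]) fun t ht h => by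
          have := P.eq₂ t (hW ht) h; have := (hm t).1 ht; tauto)
        (by omega) (by omega)
    have hd5 : ∀ q y, IsLeafAt G W' y c → (q = c ∨ G.Adj q c) →
        weight G (play G W' q) y + 5 ≤ weight G W' y := by
      intro q y hy hq
      refine drop_five (fun h => hy.1 (play_subset h)) (fun t ht hyt => ?_) hcm hy.2.2.1
      obtain rfl := hy.2.2.2 t (play_subset ht) hyt
      rw [mem_play] at ht
      tauto
    by_cases hleaf : ∃ x z s, IsLeafAt G W' x z ∧ s ∈ W' ∧ G.Adj z s
    · obtain ⟨x, z, s, hx, hs, hzs⟩ := hleaf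
      obtain ⟨v, hv⟩ := hc'.exists_gain_of_leaf hx hs hzs
      exact ⟨v, hc'.legal_and_of_gain le_rfl hv (by omega)⟩
    by_cases hy : ∃ y, G.Adj c y ∧ y ≠ b ∧ y ≠ d
    · obtain ⟨y, hcy, hyb, hyd⟩ := hy
      have hyW : y ∉ W := fun h' => by
        have := P.eq₄ y h' hcy
        tauto
      have hyW' : y ∉ W' := fun h' => hyW (hW h')
      by_cases hyl : ∃ q ∈ W', G.Adj y q ∧ q ≠ c
      · obtain ⟨q, hq, hyq, hqc⟩ := hyl
        have := gain_four (W' := play G W' y) (a := y) (b := c) (c := b) (d := d) play_subset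
          (by simp; grind [hcy.ne, P.adj₃.ne, P.adj₄.ne])
          (drop_six_of_ne (fun h => hyW' (play_subset h)) (fun z hz => (mem_play.1 hz).2.2) hcm
            hq hqc.symm hcy.symm hyq)
          (drop_ten hcm (by simp [mem_play, hcy.symm]) fun t ht => hci t (play_subset ht))
          (hd5 y b lb (Or.inr hcy.symm)) (hd5 y d ld (Or.inr hcy.symm))
        exact ⟨y, hc'.legal_and_of_gain (by norm_num) this (by omega)⟩
      · push Not at hyl
        have := gain_four (W' := play G W' c) (a := c) (b := b) (c := d) (d := y) play_subset
          (by simp; grind [hcy.ne, P.adj₃.ne, P.adj₄.ne]) (drop_played hcm)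
          (hd5 c b lb (Or.inl rfl)) (hd5 c d ld (Or.inl rfl))
          (hd5 c y ⟨hyW', hcm, hcy.symm, hyl⟩ (Or.inl rfl))
        exact ⟨c, hc'.legal_and_of_gain (by norm_num) this (by omega)⟩
    push Not at hleaf hy
    -- Now `b` and `d` are the only neighbors of `c`. Playing `c` brings the total to 50, and no
    -- reply is weak: an isolated vertex shares no dominated neighbor with another undominated
    -- vertex, and no leaf sits at a vertex that is not isolated. So the last reply gains 14.
    have h20 := gain_three (W' := play G W' c) (a := c) (b := b) (c := d) play_subset
      (by simp; grind [P.adj₃.ne, P.adj₄.ne]) (drop_played hcm)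
      (hd5 c b lb (Or.inl rfl)) (hd5 c d ld (Or.inl rfl))
    refine ⟨c, ⟨c, hcm, Or.inl rfl⟩, by omega, fun r hr => ?_⟩
    by_contra hlt
    obtain ⟨e, he, -, hw⟩ := (hc'.mono play_subset).weakReply_of_gain_lt hr (by omega)
    have hm3 : ∀ t, t ∈ play G W' c ↔ t ∈ W ∧ t ≠ p ∧ t ≠ a ∧ t ≠ b ∧ t ≠ c ∧ t ≠ d := by
      intro t
      rw [mem_play, hm]
      constructor
      · rintro ⟨⟨h1, h2, h3, h4, h5⟩, h6, -⟩
        exact ⟨h1, h2, h3, h5, h6, h4⟩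
      · rintro ⟨h1, h2, h3, h4, h5, h6⟩
        refine ⟨⟨h1, h2, h3, h6, h4⟩, h5, fun h7 => ?_⟩
        exact (P.eq₄ t h1 h7).elim h4 h6
    have heW := (hm3 e).1 he
    rcases hw with ⟨hi, hx⟩ | ⟨⟨t, ht, het⟩, hr, -⟩
    · have heiW : ∀ t ∈ W, ¬ G.Adj e t := by
        intro t ht het
        by_cases htm : t ∈ play G W' c
        · exact hi t htm het
        · have : t = p ∨ t = a ∨ t = b ∨ t = c ∨ t = d := by
            rw [hm3] at htm
            tauto
          rcases this with rfl | rfl | rfl | rfl | rfl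
          · exact (P.eq₁ e heW.1 het.symm).elim heW.2.2.1 heW.2.2.2.2.2
          · exact (P.eq₂ e heW.1 het.symm).elim heW.2.1 heW.2.2.2.1
          · exact (P.eq₃ e heW.1 het.symm).elim heW.2.2.1 heW.2.2.2.2.1
          · exact (P.eq₄ e heW.1 het.symm).elim heW.2.2.2.1 heW.2.2.2.2.2
          · exact (P.eq₅ e heW.1 het.symm).elim heW.2.2.2.2.1 heW.2.1
      obtain ⟨x, hex⟩ := hG e
      obtain ⟨t, ht, hte, hxt⟩ := hx x hex
      exact hte (hl x (fun h' => heiW x h' hex) e heW.1 heiW hex.symm t ((hm3 t).1 ht).1 hxt)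
    · have hrc : ¬ G.Adj r c := fun hrc => by
        by_cases hrb : r = b
        · subst hrb
          exact (P.eq₃ e heW.1 hr.2.2.1).elim heW.2.2.1 heW.2.2.2.2.1
        · obtain rfl := hy r hrc.symm hrb
          exact (P.eq₅ e heW.1 hr.2.2.1).elim heW.2.2.2.2.1 heW.2.1
      have hrW : r ∉ W' := fun hrW => by
        refine hr.1 (mem_play.2 ⟨hrW, ?_, fun h' => hrc h'.symm⟩)
        rintro rfl
        exact hci e (play_subset he) hr.2.2.1
      refine hleaf r e t ⟨hrW, play_subset he, hr.2.2.1, fun q hq hrq => ?_⟩ (play_subset ht) het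
      refine hr.2.2.2 q (mem_play.2 ⟨hq, ?_, hci q hq⟩) hrq
      rintro rfl
      exact hrc hrq
  rcases hbc with ⟨rfl, rfl⟩ | ⟨rfl, rfl⟩
  · exact key a b' c' d P
  · exact key d b' c' a P.symm

theorem Critical.payable (h : Critical G W) (hG : ∀ x, ∃ y, G.Adj x y) (hW : W.Nonempty) :
    Payable G W := by
  by_contra hcon
  have hno : ∀ u w, ¬ IsPair G W u w := fun u w hp => hcon (h.payable_of_pair hG hp)
  have hpent : ∀ p ∈ W, ∀ a ∈ W, G.Adj p a → ∃ a b c d, IsPentagon G W p a b c d := by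
    intro p hp a ha hpa
    obtain ⟨d, hd, hpd, hda⟩ := h.exists_ne hno hp ha hpa
    obtain ⟨b, hb, hab, hbp⟩ := h.exists_ne hno ha hp hpa.symm
    obtain ⟨c, hc, hdc, hcp⟩ := h.exists_ne hno hd hp hpd.symm
    have had := h.not_triangle hp ha hd hpa hpd
    by_cases hbc : b = c
    · subst hbc
      exact absurd (h.payable_of_square hG hno hp ha hd hb hpa hpd hab.symm hdc.symm hda.symm
        hbp.symm) hcon
    by_cases hnbc : G.Adj b c
    · have hac : a ≠ c := by rintro rfl; exact had hdc.symm
      have hbd : b ≠ d := by rintro rfl; exact had hab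
      refine ⟨a, b, c, d, hp, ha, hb, hc, hd, hpa, hab, hnbc, hdc.symm, hpd.symm,
        fun t ht h' => h.eq_of_adj hp ha hd ht hpa hpd h' hda.symm,
        fun t ht h' => h.eq_of_adj ha hp hb ht hpa.symm hab h' hbp.symm,
        fun t ht h' => h.eq_of_adj hb ha hc ht hab.symm hnbc h' hac,
        fun t ht h' => h.eq_of_adj hc hb hd ht hnbc.symm hdc.symm h' hbd,
        fun t ht h' => h.eq_of_adj hd hc hp ht hdc hpd.symm h' hcp, ?_⟩
      have := hpa.ne
      have := hpd.ne
      have := hab.ne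
      have := hdc.ne
      simp
      grind
    · exact absurd (h.payable_of_path hno hp ha hd hb hc hpa hpd hab hdc hda.symm hbp.symm
        hcp.symm hbc hnbc) hcon
  have hl : ∀ x, x ∉ W → ∀ v ∈ W, (∀ t ∈ W, ¬ G.Adj v t) → G.Adj x v →
      ∀ t ∈ W, G.Adj x t → t = v := by
    intro x hx v hv hvi hxv p hp hxp
    by_contra hpv
    obtain ⟨s, hs, hps⟩ : ∃ s ∈ W, G.Adj p s := by
      by_contra! hpi
      exact hpv (h.eq_of_isolated hx hp hv hxp hxv hpi hvi)
    obtain ⟨a, b, c, d, P⟩ := hpent p hp s hs hps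
    exact hcon (P.payable_of_joined h hx hv hvi hxv hxp)
  by_cases hi : ∃ p ∈ W, ∃ a ∈ W, G.Adj p a
  · obtain ⟨p, hp, a, ha, hpa⟩ := hi
    obtain ⟨a, b, c, d, P⟩ := hpent p hp a ha hpa
    exact hcon (P.payable_of_not_joined h hG hl)
  · push Not at hi
    exact hcon (payable_of_isolated hG hW hi fun x hx v hv t ht hxv hxt =>
      hl x hx v hv (hi v hv) hxv t ht hxt)

/-- A round is settled at once by 22 + 10 or 24 + 8; only critical positions remain. -/
theorem exists_payable (hG : ∀ x, ∃ y, G.Adj x y) (hW : W.Nonempty) : Payable G W := by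
  by_cases hc : Calm G W
  · by_cases h : ∀ v, potential G W < potential G (play G W v) + 22
    · exact Critical.payable ⟨hc, h⟩ hG hW
    · push Not at h
      obtain ⟨v, hv⟩ := h
      exact hc.payable_of_gain_large hv
  · obtain ⟨v, hv | ⟨hv, hr⟩⟩ := exists_gain_of_not_calm hc
    · refine ⟨v, legal_of_gain (i := 23) hv, by omega, fun r hr => Or.inl ?_⟩
      have := gain_eight_of_legal hr
      omega
    · refine ⟨v, legal_of_gain (i := 21) hv, by omega, fun r hr' => Or.inl ?_⟩
      have := hr r hr'
      omega

end Payable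

/-! ### Transfer to the game on the hypergraph. -/

/-- The graph on the vertices of a hypergraph in which two distinct vertices are adjacent when
some edge contains both. -/
def adjGraph {α : Type*} (H : Hypergraph α) : SimpleGraph H.vertexSet where
  Adj u v := u ≠ v ∧ H.Adj u v
  symm := ⟨fun _ _ h => ⟨h.1.symm, h.2.symm⟩⟩
  loopless := ⟨fun _ h => h.1 rfl⟩

/-- `W` is the set of vertices not dominated by the selected vertices `D`. -/
structure Matches {α : Type*} (H : Hypergraph α) (D : Set α) (W : Finset H.vertexSet) : Prop where
  subset : D ⊆ H.vertexSet
  mem_iff : ∀ x : H.vertexSet, x ∈ W ↔ (x : α) ∉ H.dominated D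

section Game

variable {α : Type*} {H : Hypergraph α} {D : Set α} {W : Finset H.vertexSet} {v : H.vertexSet}
  {k : ℕ}

theorem mem_closedNeighborhood (x : H.vertexSet) :
    (x : α) ∈ H.closedNeighborhood v ↔ x = v ∨ (adjGraph H).Adj v x := by
  simp only [Hypergraph.closedNeighborhood, Hypergraph.openNeighborhood, Set.mem_union,
    Set.mem_ofPred_eq, Set.mem_singleton_iff, adjGraph, ne_eq, Subtype.ext_iff]
  grind

theorem Matches.isDominating (h : Matches H D W) (hW : W = ∅) : H.IsDominating D := by
  refine ⟨h.subset, (H.dominated_subset h.subset).antisymm fun x hx => ?_⟩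
  by_contra hx'
  have := (h.mem_iff ⟨x, hx⟩).2 hx'
  simp [hW] at this

theorem Matches.isLegalMove_iff (h : Matches H D W) :
    H.IsLegalMove D v ↔ Legal (adjGraph H) W v := by
  constructor
  · rintro ⟨hv, x, hx, hxD⟩
    have hxV := H.closedNeighborhood_subset hv hx
    exact ⟨⟨x, hxV⟩, (h.mem_iff _).2 hxD, (mem_closedNeighborhood ⟨x, hxV⟩).1 hx⟩
  · rintro ⟨x, hx, hvx⟩
    exact ⟨v.2, x, (mem_closedNeighborhood x).2 hvx, (h.mem_iff x).1 hx⟩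

theorem Matches.insert (h : Matches H D W) (v : H.vertexSet) :
    Matches H (insert (v : α) D) (play (adjGraph H) W v) := by
  refine ⟨Set.insert_subset v.2 h.subset, fun x => ?_⟩
  rw [mem_play, h.mem_iff, H.dominated_insert, Set.mem_union, mem_closedNeighborhood]
  tauto

theorem Matches.endsWithin_dominator (h : Matches H D W) (hv : Legal (adjGraph H) W v)
    (hk : H.EndsWithin k .staller (Insert.insert (v : α) D)) :
    H.EndsWithin (k + 1) .dominator D :=
  Or.inr ⟨v, h.isLegalMove_iff.2 hv, hk⟩

/-- The form `k = k' + 1` is demanded only under a legal reply, so `k = 0` is allowed when the game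
is over. -/
theorem Matches.endsWithin_staller (h : Matches H D W)
    (hk : ∀ r, Legal (adjGraph H) W r →
      ∃ k', k = k' + 1 ∧ H.EndsWithin k' .dominator (Insert.insert (r : α) D)) :
    H.EndsWithin k .staller D := by
  rcases W.eq_empty_or_nonempty with hW | ⟨x, hx⟩
  · have := h.isDominating hW
    cases k
    · exact this
    · exact Or.inl this
  · obtain ⟨k, rfl, -⟩ := hk x ⟨x, hx, Or.inl rfl⟩
    refine Or.inr fun r hr => ?_
    obtain ⟨k', hk', hr'⟩ := hk ⟨r, hr.1⟩ (h.isLegalMove_iff.1 hr)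
    obtain rfl : k = k' := by omega
    exact hr'

/-- The budget `k` may be as small as the potential divided by 16 and rounded down. Each multiple of
16 gained pays for one move and also shows that `k` has room for it. -/
theorem Matches.endsWithin_of_potential [Fintype H.vertexSet]
    (hG : ∀ x, ∃ y, (adjGraph H).Adj x y) (h : Matches H D W)
    (hk : potential (adjGraph H) W < 16 * (k + 1)) : H.EndsWithin k .dominator D := by
  induction W using Finset.strongInduction generalizing D k with
  | H W ih =>
  rcases W.eq_empty_or_nonempty with hW | hW
  · have := h.isDominating hW
    cases k
    · exact this
    · exact Or.inl this
  obtain ⟨v, hv, h16, hreply⟩ := exists_payable hG hW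
  obtain ⟨k, rfl⟩ : ∃ k', k = k' + 1 := ⟨k - 1, by omega⟩
  refine h.endsWithin_dominator hv ((h.insert v).endsWithin_staller fun r hr => ?_)
  have hr2 := ((h.insert v).insert r)
  have hss := (play_ssubset hr).trans (play_ssubset hv)
  rcases hreply r hr with h32 | ⟨v', hv', h48, hreply'⟩
  · exact ⟨k - 1, by omega, ih _ hss hr2 (by omega)⟩
  · obtain ⟨k, rfl⟩ : ∃ k', k = k' + 2 := ⟨k - 2, by omega⟩
    refine ⟨k + 1, rfl, hr2.endsWithin_dominator hv'
      ((hr2.insert v').endsWithin_staller fun r' hr' => ?_)⟩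
    have := hreply' r' hr'
    exact ⟨k - 1, by omega, ih _ (((play_ssubset hr').trans (play_ssubset hv')).trans hss)
      ((hr2.insert v').insert r') (by omega)⟩

end Game

theorem exists_adj {α : Type*} (H : Hypergraph α) (hisolated : ∀ v ∈ H.vertexSet, ¬ H.IsIsolated v)
    (hone : ∀ e ∈ H.edgeSet, e.ncard ≠ 1) (x : H.vertexSet) : ∃ y, (adjGraph H).Adj x y := by
  obtain ⟨e, he, hxe⟩ : ∃ e ∈ H.edgeSet, (x : α) ∈ e := by
    have := hisolated x x.2
    simpa [Hypergraph.IsIsolated] using this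
  obtain ⟨y, hy, hyx⟩ : ∃ y ∈ e, y ≠ x := by
    by_contra! hcon
    exact hone e he (Set.ncard_eq_one.2 ⟨x, Set.eq_singleton_iff_unique_mem.2 ⟨hxe, hcon⟩⟩)
  exact ⟨⟨y, H.subset_vertexSet_of_mem_edgeSet' he hy⟩, fun h => hyx (congrArg Subtype.val h).symm,
    e, he, hxe, hy⟩

end DominationGame

theorem mainTheorem7 {α : Type*} (H : Hypergraph α) (hfin : H.vertexSet.Finite)
    (hisolated : ∀ v ∈ H.vertexSet, ¬ H.IsIsolated v)
    (hone : ∀ e ∈ H.edgeSet, e.ncard ≠ 1) :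
    (H.gameDominationNumber : ℝ) ≤ 5 / 8 * (H.vertexSet.ncard : ℝ) := by
  have : Fintype H.vertexSet := hfin.fintype
  have hmatch : DominationGame.Matches H ∅ Finset.univ :=
    ⟨Set.empty_subset _, fun x => by simp [Hypergraph.dominated]⟩
  have hpot : DominationGame.potential (DominationGame.adjGraph H) Finset.univ =
      10 * H.vertexSet.ncard := by
    rw [DominationGame.potential, Finset.sum_congr rfl fun x _ =>
      DominationGame.weight_of_mem (Finset.mem_univ x), Finset.sum_const, Finset.card_univ,
      ← Nat.card_eq_fintype_card, Nat.card_coe_set_eq, smul_eq_mul, mul_comm]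
  -- The division is rounded down, which is what the strict bound `10 n < 16 (k + 1)` permits.
  have hk : H.gameDominationNumber ≤ 10 * H.vertexSet.ncard / 16 :=
    Nat.sInf_le (hmatch.endsWithin_of_potential (DominationGame.exists_adj H hisolated hone)
      (by omega))
  have h16 : 8 * H.gameDominationNumber ≤ 5 * H.vertexSet.ncard := by omega
  have h16' : (8 : ℝ) * H.gameDominationNumber ≤ 5 * H.vertexSet.ncard := by exact_mod_cast h16
  linarith
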